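/- **Theorem.** Let $n\ge 1$. The Stasheff polytopes $K_{n+1}$, Loday's cone complex $C(\widehat K_n)$, the collapsed multiplihedra $J'_n$ and the graph cubeahedra $\mathcal C P_{n-1}$ of the path graph $P_{n-1}$ with $n-1$ nodes are pairwise combinatorially isomorphic: polytopes $K_{n+1}$, $J'_n$, $\mathcal C P_{n-1}$ as defined below exist, and for any such polytopes the face posets of the four models (nonempty faces, the whole included, ordered by inclusion) are pairwise isomorphic. The models are as follows. 1. *Stasheff polytope $K_m$ ($m\ge2$).* A convex polytope of dimension $m-2$ whose face poset is isomorphic to the poset $\mathfrak P(m)$ of bracketings of the word $x_1\dots x_m$. A bracketing is a set of pairwise nested or disjoint brackets, each enclosing at least two consecutive letters but not the whole word; $p\le p'$ if $p$ is obtained from $p'$ by adding brackets. For $p,q\ge2$ and $1\le r\le p$, $K_p\times_r K_q$ denotes the facet of $K_{p+q-1}$ of all bracketings obtained from a bracketing of $p$ letters by substituting for the $r$-th letter a bracketed word $(\,\cdot\,)$ of $q$ letters; for sets of cells $S$ of $K_p$ and $T$ of $K_q$, $S\times_r T$ is the corresponding set of cells of $K_p\times_rK_q$. 2. *Loday's cone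 complex $C(\widehat K_n)$.* The enlarged complex $\widehat K_n$ ($n\ge2$) is obtained from $K_n$, whose cells $B$ are now regarded as $(B)x_{n+1}$, by replacing each boundary cell $K_p\times_rK_q$ ($p+q=n+1$, $p,q\ge 2$, $1\le r\le p$) by $K_{p+1}\times_rK_q$; that is, its cells are the bracketings of $x_1\dots x_{n+1}$ of the form $(B)x_{n+1}$ with $B\in\mathfrak P(n)$ or lying in one of these $K_{p+1}\times_r K_q$. Put $\widehat K_1=\varnothing$. The cone $C(\widehat K_n)$ is one cell whose boundary is $\widehat K_n\cup C(\partial\widehat K_n)$, where $C(\partial \widehat K_n)$ is divided into the cones $C(A_s)$, $2\le s\le n$, over $$A_s=(\widehat K_{s-1}\times_sK_t)\cup(K_s\times_s\widehat K_{t-1}),\qquad t=n+2-s .$$ So its closed cells are the closed cells of $\widehat K_n$, the whole $C(\widehat K_n)$, and the cones $C\big(\bigcap_{s\in S}A_s\big)$, $\varnothing\ne S\subseteq\{2,\dots,n\}$ (with $C(\varnothing)$ the apex), ordered by inclusion. 3. *Collapsed multiplihedron $J'_n$.* A convex polytope of dimension $n-1$ whose face poset is isomorphic to $\mathfrak J'_n$.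 The elements of $\mathfrak J'_n$ are the expressions $$f(X_{11}\cdot X_{12}\cdots X_{1m_1})\,f(X_{21}\cdots X_{2m_2})\cdots f(X_{k1}\cdots X_{km_k}),\qquad k\ge 1,\ m_i\ge1,$$ in which the $X_{ij}$ are bracketed words (rules of association) that together use the letters $a_1,\dots,a_n$ once each in this order, and the dots separate the words inside each $f$; no brackets are put around the factors $f(\dots)$. One has $P\preceq P'$ if $P$ is obtained from $P'$ by finitely many (possibly zero) operations of the following kinds: adding brackets inside some $X_{ij}$; replacing a dot by $)f($; removing one or more consecutive dots inside one $f$ and enclosing all words adjacent to them by a pair of brackets, i.e. replacing $X\cdot Y\cdots Z$ by the single word $((X)(Y)\cdots(Z))$, where redundant brackets (around one letter or around the whole argument of $f$) are ignored. 4. *Graph cubeahedron $\mathcal CG$.* For a graph $G$ with node set $V$, a round tube is a nonempty set of nodes inducing a connected subgraph. In the cube $[0,1]^V$, a round tube $t$ corresponds to the face $\{x_v=0\text{ for all }v\in t\}$. A graph cubeahedron $\mathcal CG$ is any polytope obtained from the cube by truncating successively the faces that correspond to all the round tubes, in increasing order of dimension. Here truncating a polytope at a face means intersecting it with a closed half-space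 that excludes exactly the vertices in that face and has all other vertices in its interior. -/

import Mathlib

/-!
# Four models of the associahedra

Letters of a word are numbered `1, …, n`; a bracket is the pair `(i, j)` of the positions of its
first and last letter.
-/

namespace Associahedra

/-! ## Convex polytopes and their face posets -/

section Polytopes

variable {E : Type*} [AddCommGroup E] [Module ℝ E] [TopologicalSpace E]

/-- A (nonempty) convex polytope: the convex hull of a nonempty finite set. -/
def IsConvexPolytope (P : Set E) : Prop :=
  ∃ s : Finset E, s.Nonempty ∧ P = convexHull ℝ (s : Set E)

/-- `P` has (affine) dimension `k`. -/
def HasDim (P : Set E) (k : ℕ) : Prop :=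
  Module.finrank ℝ (vectorSpan ℝ P) = k

/-- The face poset of a convex polytope: its nonempty faces, the polytope itself included,
ordered by inclusion. (All faces of a polytope are exposed.) Two polytopes are combinatorially
isomorphic when their face posets are isomorphic. -/
abbrev FacePoset (P : Set E) : Type _ :=
  {F : Set E // F.Nonempty ∧ IsExposed ℝ P F}

/-- `Q` is a truncation of the polytope `P` at its face `F`: a half-space that cuts off the
vertices of `P` in `F` and keeps all the other vertices of `P` in its interior. -/
def IsTruncation (P F Q : Set E) : Prop :=
  ∃ (l : E →L[ℝ] ℝ) (c : ℝ),
    (∀ v ∈ P.extremePoints ℝ, v ∈ F → c < l v) ∧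
    (∀ v ∈ P.extremePoints ℝ, v ∉ F → l v < c) ∧
    Q = {x ∈ P | l x ≤ c}

end Polytopes

/-! ## Bracketings and Stasheff polytopes -/

/-- Two brackets are admissible together: nested or disjoint. -/
def BracketsCompatible (b c : ℕ × ℕ) : Prop :=
  (b.1 ≤ c.1 ∧ c.2 ≤ b.2) ∨ (c.1 ≤ b.1 ∧ b.2 ≤ c.2) ∨ b.2 < c.1 ∨ c.2 < b.1

/-- `B` is a bracketing of a word with `n` letters. Every bracket encloses at least two letters;
the redundant bracket around the whole word is not written. -/
def IsBracketing (n : ℕ) (B : Finset (ℕ × ℕ)) : Prop :=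
  (∀ b ∈ B, 1 ≤ b.1 ∧ b.1 < b.2 ∧ b.2 ≤ n ∧ b ≠ (1, n)) ∧
  ∀ b ∈ B, ∀ c ∈ B, BracketsCompatible b c

/-- The set of all bracketings of a word with `n` letters: the cells of `K_n`. -/
def bracketings (n : ℕ) : Set (Finset (ℕ × ℕ)) :=
  {B | IsBracketing n B}

/-- The poset `𝔓(n)` of bracketings: `p ≤ p'` if `p` is obtained from `p'` by adding brackets. -/
abbrev BracketingPoset (n : ℕ) : Type :=
  (↥(bracketings n))ᵒᵈ

/-- `K` is a Stasheff polytope `K_n`: a convex polytope of dimension `n - 2` whose face poset is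
isomorphic to the poset of bracketings of a word with `n` letters. -/
def IsStasheffPolytope (n : ℕ) {d : ℕ} (K : Set (Fin d → ℝ)) : Prop :=
  2 ≤ n ∧ IsConvexPolytope K ∧ HasDim K (n - 2) ∧ Nonempty (FacePoset K ≃o BracketingPoset n)

/-! ## Loday's cone construction -/

/-- Move all brackets `k` letters to the right. -/
def shiftBrackets (k : ℕ) (B : Finset (ℕ × ℕ)) : Finset (ℕ × ℕ) :=
  B.image fun b => (b.1 + k, b.2 + k)

/-- Substitute the bracketed word `(b)` with `q` letters for the `r`-th letter of the bracketed
word `a`. -/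
def graft (r q : ℕ) (a b : Finset (ℕ × ℕ)) : Finset (ℕ × ℕ) :=
  insert (r, r + q - 1)
    ((a.image fun c =>
        (if c.1 ≤ r then c.1 else c.1 + (q - 1), if c.2 < r then c.2 else c.2 + (q - 1))) ∪
      shiftBrackets (r - 1) b)

/-- The cells of `S ×_r T`, for sets of cells `S` of `K_p` and `T` of `K_q`. In particular
`K_p ×_r K_q` is `faceProd r q (bracketings p) (bracketings q)`, a facet of `K_{p+q-1}`. -/
def faceProd (r q : ℕ) (S T : Set (Finset (ℕ × ℕ))) : Set (Finset (ℕ × ℕ)) :=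
  {B | ∃ a ∈ S, ∃ b ∈ T, B = graft r q a b}

/-- The cells of the enlarged complex `K̂_n`. It consists of the original `K_n` (a cell `B` of it
becomes `(B) x_{n+1}`) and, for each cell `K_p ×_r K_q` of the boundary of `K_n`
(`p + q = n + 1`, `p, q ≥ 2`, `1 ≤ r ≤ p`), of the enlarged cell `K_{p+1} ×_r K_q`. By convention
`K̂_1` is empty. -/
def enlargement (n : ℕ) : Set (Finset (ℕ × ℕ)) :=
  {B | 2 ≤ n ∧ ∃ B' ∈ bracketings n, B = insert (1, n) B'} ∪
  {B | ∃ p q r : ℕ, p + q = n + 1 ∧ 2 ≤ p ∧ 2 ≤ q ∧ 1 ≤ r ∧ r ≤ p ∧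
    B ∈ faceProd r q (bracketings (p + 1)) (bracketings q)}

/-- The part `(K̂_{s-1} ×_s K_t) ∪ (K_s ×_s K̂_{t-1})`, `t = n + 2 - s`, of the boundary of `K̂_n`.
The cone over it is the facet `K_s ×_s K_t` of `C(K̂_n)`. -/
def boundaryPart (n s : ℕ) : Set (Finset (ℕ × ℕ)) :=
  faceProd s (n + 2 - s) (enlargement (s - 1)) (bracketings (n + 2 - s)) ∪
  faceProd s (n + 2 - s) (bracketings s) (enlargement (n + 1 - s))

/-- The closed cell of `K̂_n` labelled by `x`, as the set of the cells of `K̂_n` that it contains. -/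
def closedCell (n : ℕ) (x : Finset (ℕ × ℕ)) : Set (Finset (ℕ × ℕ)) :=
  {y ∈ enlargement n | x ⊆ y}

/-- The closed cells of `C(K̂_n)`. Each is recorded as the set of the cells of `K̂_n` that it
contains, together with `none`, which stands for the apex of the cone, if it contains the apex.
There are
* the cells of `K̂_n`, which do not contain the apex;
* the cells with apex: the whole of `C(K̂_n)`, the facets `C(A_s)`, `2 ≤ s ≤ n`, into which
  `C(∂K̂_n)` is divided (`A_s = boundaryPart n s`), and their intersections
  `⋂ C(A_s) = C(⋂ A_s)`. (`S = ∅` gives `C(K̂_n)`, and `C(∅)` is the apex.) -/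
def lodayCells (n : ℕ) : Set (Set (Option (Finset (ℕ × ℕ)))) :=
  {c | ∃ x ∈ enlargement n, c = some '' closedCell n x} ∪
  {c | ∃ S : Finset ℕ, S ⊆ Finset.Icc 2 n ∧
    c = insert none (some '' {y ∈ enlargement n | ∀ s ∈ S, y ∈ boundaryPart n s})}

/-- The face poset of Loday's cone complex `C(K̂_n)`: its closed cells, ordered by inclusion. -/
abbrev LodayPoset (n : ℕ) : Type :=
  ↥(lodayCells n)

/-! ## Collapsed multiplihedra -/

/-- A rule of association `X` of some consecutive letters: their number, and a bracketing of them
(with positions counted from the first of these letters). -/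
abbrev AssocRule : Type := ℕ × Finset (ℕ × ℕ)

/-- The brackets of `(X)`; around a single letter the outer bracket is redundant and dropped. -/
def enclose (X : AssocRule) : Finset (ℕ × ℕ) :=
  if 2 ≤ X.1 then insert (1, X.1) X.2 else X.2

/-- The rule of association `(X₁)(X₂)⋯(Xₘ)`, for `m ≥ 2`. -/
def juxtapose : List AssocRule → AssocRule
  | [] => (0, ∅)
  | X :: Xs => (X.1 + (juxtapose Xs).1, enclose X ∪ shiftBrackets X.1 (juxtapose Xs).2)

/-- The elements of type I, type II and degenerate type III: products
`f(X₁₁ · X₁₂ · ⋯) f(X₂₁ · X₂₂ · ⋯) ⋯` of one or more factors, each of them `f` of one or more rules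
of association separated by dots, where the letters involved are `a₁, …, aₙ` in this order. The
codomain is associative, so no brackets are put around factors. -/
structure CollapsedElement (n : ℕ) where
  factors : List (List AssocRule)
  ne_nil : ∀ E ∈ factors, E ≠ []
  isBracketing : ∀ E ∈ factors, ∀ X ∈ E, 1 ≤ X.1 ∧ IsBracketing X.1 X.2
  length_eq : (factors.map fun E => (E.map Prod.fst).sum).sum = n

/-- `Operation P P'`: `P` is obtained from `P'` by one operation. -/
inductive Operation : List (List AssocRule) → List (List AssocRule) → Prop
  /-- Adding brackets in the domain. -/
  | addBrackets (Es Fs : List (List AssocRule)) (Xs Ys : List AssocRule) (k : ℕ)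
      (B B' : Finset (ℕ × ℕ)) (h : B' ⊆ B) :
      Operation (Es ++ (Xs ++ (k, B) :: Ys) :: Fs) (Es ++ (Xs ++ (k, B') :: Ys) :: Fs)
  /-- Replacing a dot by `)f(`. -/
  | splitDot (Es Fs : List (List AssocRule)) (Xs Ys : List AssocRule)
      (hX : Xs ≠ []) (hY : Ys ≠ []) :
      Operation (Es ++ Xs :: Ys :: Fs) (Es ++ (Xs ++ Ys) :: Fs)
  /-- Removing one or more consecutive dots by adding a pair of brackets that encloses all the
  elements adjacent to the removed dots. -/
  | removeDots (Es Fs : List (List AssocRule)) (Xs Zs Ys : List AssocRule)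
      (hZ : 2 ≤ Zs.length) :
      Operation (Es ++ (Xs ++ juxtapose Zs :: Ys) :: Fs) (Es ++ (Xs ++ Zs ++ Ys) :: Fs)

/-- The order of `𝔍'_n`: `P ≤ P'` if `P` is obtained from `P'` by operations. -/
instance (n : ℕ) : LE (CollapsedElement n) where
  le P P' := Relation.ReflTransGen
    (fun Q' Q : CollapsedElement n => Operation Q.factors Q'.factors) P' P

/-- `J` is a collapsed multiplihedron `J'_n`: a convex polytope of dimension `n - 1` whose face
poset is isomorphic to `𝔍'_n`. -/
def IsCollapsedMultiplihedron (n : ℕ) {d : ℕ} (J : Set (Fin d → ℝ)) : Prop :=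
  1 ≤ n ∧ IsConvexPolytope J ∧ HasDim J (n - 1) ∧ Nonempty (FacePoset J ≃o CollapsedElement n)

/-! ## Graph cubeahedra -/

section Cubeahedra

variable {V : Type*}

/-- A round tube: a set of nodes whose induced graph is connected (hence nonempty). -/
def IsRoundTube (G : SimpleGraph V) (t : Finset V) : Prop :=
  (G.induce (t : Set V)).Connected

/-- `IteratedTruncation ts P R`: `R` arises from `P` by truncating, one after the other in the
order of the list, the faces that correspond to the sets of nodes in `ts`. In the cube `[0,1]^V`
the facet `x_v = 0` represents the node `v` as a round tube, the facet `x_v = 1` represents it as a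
square tube, and a round tube `t` corresponds to the intersection of the facets `x_v = 0`,
`v ∈ t`. -/
inductive IteratedTruncation : List (Finset V) → Set (V → ℝ) → Set (V → ℝ) → Prop
  | nil (P : Set (V → ℝ)) : IteratedTruncation [] P P
  | cons (t : Finset V) (ts : List (Finset V)) (P Q R : Set (V → ℝ))
      (hQ : IsTruncation P {x ∈ P | ∀ v ∈ t, x v = 0} Q) (hR : IteratedTruncation ts Q R) :
      IteratedTruncation (t :: ts) P R

/-- `C` is a graph cubeahedron of `G`: it is obtained from the cube by truncating the faces that
correspond to the round tubes, in increasing order of dimension (that is, larger tubes first). -/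
def IsGraphCubeahedron (G : SimpleGraph V) (C : Set (V → ℝ)) : Prop :=
  ∃ ts : List (Finset V), ts.Nodup ∧ (∀ t, t ∈ ts ↔ IsRoundTube G t) ∧
    ts.Pairwise (fun s t => t.card ≤ s.card) ∧ IteratedTruncation ts (Set.Icc 0 1) C

end Cubeahedra

end Associahedra

open Associahedra

/-! Each of the four posets is the set of bracketings of n + 1 letters ordered by reverse inclusion.
For the Stasheff polytope this is the definition; the other three are compared with it, and the six
isomorphisms are composites.

Graph cubeahedra. Let a polytope be given by inequalities such that every subset of a set of
simultaneously tight constraints is the exact tight set of some point. Its faces then correspond,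
with order reversed, to the simplicial complex of tight sets (`IsSimplePresentation.facePosetIso`).
Truncating a face is a stellar subdivision of this complex, whichever half-space is chosen
(`IsSimplePresentation.truncation`). Starting from the cube, the iterated subdivision depends only
on the graph: its simplices are the design tubings (`mem_subdivide_cubeComplex`). For a path the
round tubes are intervals; tubes become brackets and compatibility of tubes becomes compatibility of
brackets (`isDesignTubing_pathGraph_iff`, `pathTubingIso`).

Collapsed multiplihedra. Put an extra letter x in front and read a product of factors E₁, …, Eₖ as
the left-nested word (⋯((x E₁) E₂)⋯) Eₖ. Every operation only adds brackets (`Operation.refines`),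
and every single admissible bracket is added by one operation (`exists_operation_leftNest_insert`).
Hence the order is reverse inclusion and all bracketings occur.

Loday's cone. The cells of the enlarged complex are the bracketings with some bracket that avoids
the last letter (`mem_enlargement_iff`), and A_s consists of those that contain the bracket (s, n +
1) (`mem_boundaryPart_iff`). The remaining bracketings consist only of brackets (s, n + 1), s ∈ S,
for a set S of numbers from 2 to n, and they label the cones over the intersections of the A_s.
Distinct labels give distinct cones (`coneCell_subset_iff`).

Existence. Cutting close enough to each face produces a graph cubeahedron; the one of the path also
serves as Stasheff polytope and as collapsed multiplihedron. -/

namespace Associahedra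

/-! ### Simple polytopes given by inequalities, and their faces -/

section SimplePresentation

open Filter Topology

variable {E : Type*} [NormedAddCommGroup E] [NormedSpace ℝ E] {ι : Type*}

open Classical in
/-- The set of the constraints `l i ≤ c i`, `i ∈ I`, that are equalities at `x`. -/
noncomputable def tight (I : Finset ι) (l : ι → E →L[ℝ] ℝ) (c : ι → ℝ) (x : E) : Finset ι :=
  I.filter fun i => l i x = c i

theorem mem_tight {I : Finset ι} {l : ι → E →L[ℝ] ℝ} {c : ι → ℝ} {x : E} {i : ι} :
    i ∈ tight I l c x ↔ i ∈ I ∧ l i x = c i := by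
  simp [tight]

/-- `P` is the compact solution set of the constraints `l i ≤ c i`, `i ∈ I`, and every set of
constraints that are tight at some point of `P` is the exact set of tight constraints of another
point. So `P` is a simple polytope, some of the constraints possibly being redundant. -/
structure IsSimplePresentation (I : Finset ι) (l : ι → E →L[ℝ] ℝ) (c : ι → ℝ) (P : Set E) :
    Prop where
  eq : P = {x | ∀ i ∈ I, l i x ≤ c i}
  compact : IsCompact P
  exists_tight_eq : ∀ x ∈ P, ∀ S ⊆ tight I l c x, ∃ y ∈ P, tight I l c y = S

/-- The simplicial complex of the sets of constraints that define the faces of `P`. -/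
def dualComplex (I : Finset ι) (l : ι → E →L[ℝ] ℝ) (c : ι → ℝ) (P : Set E) : Set (Finset ι) :=
  {S | ∃ y ∈ P, tight I l c y = S}

/-- The face of `P` on which the constraints in `S` are tight. -/
def tightFace (I : Finset ι) (l : ι → E →L[ℝ] ℝ) (c : ι → ℝ) (P : Set E) (S : Finset ι) : Set E :=
  {x ∈ P | S ⊆ tight I l c x}

/-- The maximizers of `g` form a compact exposed face, which has an extreme point by Krein–Milman;
extreme points of a face are extreme points of the whole set. -/
theorem exists_extremePoint_forall_le {F : Set E} (hF : IsCompact F) (hne : F.Nonempty)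
    (g : E →L[ℝ] ℝ) : ∃ v ∈ F.extremePoints ℝ, ∀ y ∈ F, g y ≤ g v := by
  have hexp : IsExposed ℝ F (g.toExposed F) := ContinuousLinearMap.toExposed.isExposed
  obtain ⟨x, hx, hmax⟩ := hF.exists_isMaxOn hne g.continuous.continuousOn
  obtain ⟨v, hv⟩ := (hexp.isCompact hF).extremePoints_nonempty ⟨x, hx, fun y hy => hmax hy⟩
  exact ⟨v, hexp.isExtreme.extremePoints_subset_extremePoints hv, hv.1.2⟩

namespace IsSimplePresentation

variable {I : Finset ι} {l : ι → E →L[ℝ] ℝ} {c : ι → ℝ} {P : Set E}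

theorem mem_iff (h : IsSimplePresentation I l c P) {x : E} : x ∈ P ↔ ∀ i ∈ I, l i x ≤ c i := by
  conv_lhs => rw [h.eq]
  rfl

theorem convex (h : IsSimplePresentation I l c P) : Convex ℝ P := by
  intro x hx y hy a b ha hb hab
  rw [h.mem_iff] at *
  intro i hi
  have h1 := mul_le_mul_of_nonneg_left (hx i hi) ha
  have h2 := mul_le_mul_of_nonneg_left (hy i hi) hb
  simp only [map_add, map_smul, smul_eq_mul]
  calc a * l i x + b * l i y ≤ a * c i + b * c i := add_le_add h1 h2
    _ = c i := by rw [← add_mul, hab, one_mul]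

/-- The slacks are nonnegative on `P` and affine, so a weighted mean with positive weights vanishes
only if both slacks do. -/
theorem tight_combo [DecidableEq ι] (h : IsSimplePresentation I l c P) {x y : E} (hx : x ∈ P)
    (hy : y ∈ P) {a b : ℝ} (ha : 0 < a) (hb : 0 < b) (hab : a + b = 1) :
    tight I l c (a • x + b • y) = tight I l c x ∩ tight I l c y := by
  ext i
  simp only [Finset.mem_inter, mem_tight, map_add, map_smul, smul_eq_mul]
  rw [h.mem_iff] at hx hy
  constructor
  · rintro ⟨hi, he⟩
    have h1 := hx i hi
    have h2 := hy i hi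
    have hb' : b = 1 - a := by linarith
    have h3 := mul_nonneg ha.le (sub_nonneg.2 h1)
    have h4 := mul_nonneg hb.le (sub_nonneg.2 h2)
    have h5 : a * (c i - l i x) + b * (c i - l i y) = 0 := by
      have : a * c i + b * c i = c i := by rw [← add_mul, hab, one_mul]
      linarith
    refine ⟨⟨hi, ?_⟩, hi, ?_⟩
    · have : a * (c i - l i x) = 0 := by linarith
      rcases mul_eq_zero.1 this with h | h <;> linarith
    · have : b * (c i - l i y) = 0 := by linarith
      rcases mul_eq_zero.1 this with h | h <;> linarith
  · rintro ⟨⟨hi, h1⟩, -, h2⟩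
    exact ⟨hi, by rw [h1, h2, ← add_mul, hab, one_mul]⟩

/-- Constraints tight at `x` are constant in direction `d`; the others have room at `x` and keep it
by continuity. -/
theorem eventually_add_smul_mem (h : IsSimplePresentation I l c P) {x d : E} (hx : x ∈ P)
    (hd : ∀ i ∈ tight I l c x, l i d = 0) : ∀ᶠ ε in 𝓝 (0 : ℝ), x + ε • d ∈ P := by
  simp only [h.mem_iff]
  rw [Filter.eventually_all_finset]
  intro i hi
  by_cases ht : i ∈ tight I l c x
  · refine Eventually.of_forall fun ε => ?_
    simp [hd i ht, (mem_tight.1 ht).2]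
  · have hlt : l i x < c i :=
      lt_of_le_of_ne (h.mem_iff.1 hx i hi) fun he => ht (mem_tight.2 ⟨hi, he⟩)
    have hc : ContinuousAt (fun ε : ℝ => l i (x + ε • d)) 0 := by fun_prop
    have : ∀ᶠ ε in 𝓝 (0 : ℝ), l i (x + ε • d) < c i :=
      hc.eventually_lt continuousAt_const (by simpa using hlt)
    exact this.mono fun _ h => h.le

theorem exists_pos_add_sub_smul_mem (h : IsSimplePresentation I l c P) {x d : E} (hx : x ∈ P)
    (hd : ∀ i ∈ tight I l c x, l i d = 0) :
    ∃ ε : ℝ, 0 < ε ∧ x + ε • d ∈ P ∧ x - ε • d ∈ P := by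
  have h1 := h.eventually_add_smul_mem hx hd
  have h2 := h.eventually_add_smul_mem (d := -d) hx (by simpa using hd)
  have h3 : ∀ᶠ ε in 𝓝[>] (0 : ℝ), 0 < ε := eventually_mem_nhdsWithin
  obtain ⟨ε, ⟨ha, hb⟩, hc⟩ := ((h1.and h2).filter_mono nhdsWithin_le_nhds |>.and h3).exists
  exact ⟨ε, hc, ha, by simpa [sub_eq_add_neg] using hb⟩

/-- The segment from `y` to `x` can be prolonged a little beyond `x` inside `P`. If `g` grew from
`y` to `x`, it would exceed its maximum there. -/
theorem apply_le_of_tight_subset (h : IsSimplePresentation I l c P) {x y : E} (hx : x ∈ P)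
    (hxy : tight I l c x ⊆ tight I l c y) {g : E →L[ℝ] ℝ} (hg : ∀ z ∈ P, g z ≤ g x) :
    g x ≤ g y := by
  obtain ⟨ε, hε, h1, -⟩ := h.exists_pos_add_sub_smul_mem (d := x - y) hx fun i hi => by
    rw [map_sub, (mem_tight.1 hi).2, (mem_tight.1 (hxy hi)).2, sub_self]
  have := hg _ h1
  simp only [map_add, map_smul, map_sub, smul_eq_mul] at this
  have : ε * (g x - g y) ≤ 0 := by linarith
  nlinarith [nonpos_of_mul_nonpos_right this hε]

/-- Otherwise `x` is the midpoint of a proper segment of `P` in direction `x - y`. A vertex is thus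
determined by its tight set, which makes the vertices finite in number. -/
theorem eq_of_extremePoint (h : IsSimplePresentation I l c P) {x y : E}
    (hx : x ∈ P.extremePoints ℝ) (hxy : tight I l c x ⊆ tight I l c y) : x = y := by
  obtain ⟨ε, hε, h1, h2⟩ := h.exists_pos_add_sub_smul_mem (d := x - y) hx.1 fun i hi => by
    rw [map_sub, (mem_tight.1 hi).2, (mem_tight.1 (hxy hi)).2, sub_self]
  have hseg : x ∈ openSegment ℝ (x + ε • (x - y)) (x - ε • (x - y)) := by
    refine ⟨1 / 2, 1 / 2, by norm_num, by norm_num, by norm_num, ?_⟩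
    rw [← smul_add]
    have : x + ε • (x - y) + (x - ε • (x - y)) = (2 : ℝ) • x := by rw [two_smul]; abel
    rw [this, smul_smul]
    norm_num
  have := hx.2 h1 h2 hseg
  have h0 : ε • (x - y) = 0 := by simpa using this
  rcases smul_eq_zero.1 h0 with h | h
  · exact absurd h hε.ne'
  · exact sub_eq_zero.1 h

theorem finite_extremePoints (h : IsSimplePresentation I l c P) :
    (P.extremePoints ℝ).Finite := by
  refine Set.Finite.of_finite_image (f := tight I l c) ?_ ?_
  · refine (I.powerset.finite_toSet).subset ?_
    rintro _ ⟨x, -, rfl⟩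
    simp only [Finset.coe_powerset, Set.mem_preimage, Set.mem_powerset_iff, Finset.coe_subset]
    exact fun i hi => (mem_tight.1 hi).1
  · intro x hx y hy hxy
    exact h.eq_of_extremePoint hx (le_of_eq hxy)

theorem isConvexPolytope (h : IsSimplePresentation I l c P) (hne : P.Nonempty) :
    IsConvexPolytope P := by
  refine ⟨h.finite_extremePoints.toFinset, ?_, ?_⟩
  · simpa using h.compact.extremePoints_nonempty hne
  · rw [Set.Finite.coe_toFinset]
    conv_lhs => rw [← closure_convexHull_extremePoints h.compact h.convex]
    exact (h.finite_extremePoints.isClosed_convexHull ℝ).closure_eq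

/-- A point with no tight constraint is an interior point. -/
theorem hasDim (h : IsSimplePresentation I l c P) (h0 : ∅ ∈ dualComplex I l c P) :
    HasDim P (Module.finrank ℝ E) := by
  obtain ⟨y, hy, hty⟩ := h0
  have hint : (interior P).Nonempty := by
    refine ⟨y, mem_interior_iff_mem_nhds.2 ?_⟩
    have : ∀ᶠ z in 𝓝 y, ∀ i ∈ I, l i z ≤ c i := by
      rw [Filter.eventually_all_finset]
      intro i hi
      have hlt : l i y < c i := lt_of_le_of_ne (h.mem_iff.1 hy i hi) fun he => by
        have : i ∈ tight I l c y := mem_tight.2 ⟨hi, he⟩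
        simp [hty] at this
      exact ((l i).continuous.continuousAt.eventually_lt continuousAt_const hlt).mono
        fun _ h => h.le
    exact this.mono fun z hz => h.mem_iff.2 hz
  rw [HasDim, ← direction_affineSpan, affineSpan_eq_top_of_nonempty_interior
    (hint.mono (interior_mono (subset_convexHull ℝ P)) |> fun h' => by
      rwa [h.convex.convexHull_eq] at h' ⊢), AffineSubspace.direction_top]
  exact finrank_top ℝ E

theorem dualComplex_mono (h : IsSimplePresentation I l c P) {S T : Finset ι}
    (hT : T ∈ dualComplex I l c P) (hST : S ⊆ T) : S ∈ dualComplex I l c P := by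
  obtain ⟨y, hy, rfl⟩ := hT
  exact h.exists_tight_eq y hy S hST

theorem isExposed_tightFace (h : IsSimplePresentation I l c P) {S : Finset ι} :
    IsExposed ℝ P (tightFace I l c P S) := by
  rintro ⟨x, hx, hxS⟩
  -- On `P` the sum of the forms in `S` is at most the sum of their bounds, with equality exactly
  -- when all of `S` is tight; `x` shows that the bound is attained.
  refine ⟨∑ i ∈ S, l i, Set.ext fun y => and_congr_right fun hy => ?_⟩
  simp only [sum_apply]
  have hle : ∀ z ∈ P, ∀ i ∈ S, l i z ≤ c i := fun z hz i hi =>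
    h.mem_iff.1 hz i (mem_tight.1 (hxS hi)).1
  constructor
  · intro hyS z hz
    exact Finset.sum_le_sum fun i hi => (hle z hz i hi).trans (mem_tight.1 (hyS hi)).2.ge
  · intro hmax i hi
    refine mem_tight.2 ⟨(mem_tight.1 (hxS hi)).1, ?_⟩
    by_contra hne
    have h1 : ∑ i ∈ S, l i y < ∑ i ∈ S, c i :=
      Finset.sum_lt_sum (hle y hy) ⟨i, hi, lt_of_le_of_ne (hle y hy i hi) hne⟩
    have h2 : ∑ i ∈ S, l i x = ∑ i ∈ S, c i :=
      Finset.sum_congr rfl fun i hi => (mem_tight.1 (hxS hi)).2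
    linarith [hmax x hx]

/-- Take `x` in `F` with a minimal tight set, a relative interior point. The midpoint of `x` and any
`y` in `F` has the intersection of both tight sets, so minimality forces the tight set of `x` into
that of `y`. -/
theorem exists_eq_tightFace (h : IsSimplePresentation I l c P) {F : Set E} (hne : F.Nonempty)
    (hF : IsExposed ℝ P F) : ∃ x ∈ F, F = tightFace I l c P (tight I l c x) := by
  classical
  obtain ⟨g, rfl⟩ := hF hne
  have hFc : Convex ℝ {x ∈ P | ∀ y ∈ P, g y ≤ g x} := hF.convex h.convex
  obtain ⟨x, hx, hmin⟩ := exists_minimalFor_of_wellFoundedLT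
    (fun x => x ∈ {x ∈ P | ∀ y ∈ P, g y ≤ g x}) (fun x => tight I l c x) hne
  refine ⟨x, hx, Set.Subset.antisymm (fun y hy => ⟨hy.1, ?_⟩) fun y hy => ⟨hy.1, fun z hz => ?_⟩⟩
  · have hm := hFc hx hy (a := 1 / 2) (b := 1 / 2) (by norm_num) (by norm_num) (by norm_num)
    have ht := h.tight_combo hx.1 hy.1 (a := 1 / 2) (b := 1 / 2) (by norm_num) (by norm_num)
      (by norm_num)
    have := hmin hm (by simp only [ht]; exact Finset.inter_subset_left)
    simp only [ht] at this
    exact this.trans Finset.inter_subset_right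
  · exact (hx.2 z hz).trans (h.apply_le_of_tight_subset hx.1 hy.2 hx.2)

/-- The faces of a simple polytope correspond to the simplices of the dual complex. -/
noncomputable def facePosetIso (h : IsSimplePresentation I l c P) :
    (↥(dualComplex I l c P))ᵒᵈ ≃o FacePoset P where
  toEquiv := Equiv.ofBijective
    (fun S => ⟨tightFace I l c P (OrderDual.ofDual S).1, by
      obtain ⟨y, hy, hS⟩ := (OrderDual.ofDual S).2
      exact ⟨⟨y, hy, hS.ge⟩, h.isExposed_tightFace⟩⟩) (by
      constructor
      · rintro ⟨S, y, hy, rfl⟩ ⟨T, z, hz, rfl⟩ he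
        have he : tightFace I l c P (tight I l c y) = tightFace I l c P (tight I l c z) :=
          congrArg Subtype.val he
        have h1 : y ∈ tightFace I l c P (tight I l c z) := he ▸ ⟨hy, subset_rfl⟩
        have h2 : z ∈ tightFace I l c P (tight I l c y) := he ▸ ⟨hz, subset_rfl⟩
        exact Subtype.ext (h2.2.antisymm h1.2)
      · rintro ⟨F, hne, hF⟩
        obtain ⟨x, hx, hFx⟩ := h.exists_eq_tightFace hne hF
        exact ⟨OrderDual.toDual ⟨tight I l c x, x, hF.subset hx, rfl⟩, Subtype.ext hFx.symm⟩)
  map_rel_iff' := by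
    rintro ⟨S, y, hy, rfl⟩ ⟨T, z, hz, rfl⟩
    constructor
    · intro hle
      have : y ∈ tightFace I l c P (tight I l c z) := hle ⟨hy, subset_rfl⟩
      exact this.2
    · intro hle x hx
      exact ⟨hx.1, fun i hi => hx.2 (hle hi)⟩

end IsSimplePresentation

end SimplePresentation

/-! ### Truncation as stellar subdivision of the dual complex -/

section Truncation

open Filter Topology

variable {E : Type*} [NormedAddCommGroup E] [NormedSpace ℝ E] {ι : Type*}

/-- The stellar subdivision of a simplicial complex at the simplex `S₀`, with new vertex `j`. -/
def stellar [DecidableEq ι] (S₀ : Finset ι) (j : ι) (Δ : Set (Finset ι)) : Set (Finset ι) :=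
  {S | ¬S₀ ⊆ S ∧ (if j ∈ S then S.erase j ∪ S₀ else S) ∈ Δ}

namespace IsSimplePresentation

variable {I : Finset ι} {l : ι → E →L[ℝ] ℝ} {c : ι → ℝ} {P : Set E}

theorem exists_extremePoint_tightFace (h : IsSimplePresentation I l c P) {S : Finset ι}
    (hS : (tightFace I l c P S).Nonempty) (g : E →L[ℝ] ℝ) :
    ∃ v ∈ P.extremePoints ℝ, v ∈ tightFace I l c P S ∧ ∀ y ∈ tightFace I l c P S, g y ≤ g v := by
  have hexp := h.isExposed_tightFace (S := S)
  obtain ⟨v, hv, hmax⟩ := exists_extremePoint_forall_le (hexp.isCompact h.compact) hS g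
  exact ⟨v, hexp.isExtreme.extremePoints_subset_extremePoints hv, hv.1, hmax⟩

/-- If all vertices of the face of `S` lay in the face of `S₀`, so would their closed convex hull,
including the point whose tight set is exactly `S`. -/
theorem exists_extremePoint_notMem (h : IsSimplePresentation I l c P) {S S₀ : Finset ι}
    (hS : S ∈ dualComplex I l c P) (hS₀ : ¬S₀ ⊆ S) :
    ∃ v ∈ P.extremePoints ℝ, v ∈ tightFace I l c P S ∧ v ∉ tightFace I l c P S₀ := by
  obtain ⟨y, hy, rfl⟩ := hS
  have hexp := h.isExposed_tightFace (S := tight I l c y)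
  have hexp₀ := h.isExposed_tightFace (S := S₀)
  by_contra! hcon
  have hsub : (tightFace I l c P (tight I l c y)).extremePoints ℝ ⊆ tightFace I l c P S₀ :=
    fun v hv => hcon v (hexp.isExtreme.extremePoints_subset_extremePoints hv) hv.1
  have hy' : y ∈ tightFace I l c P S₀ := by
    have h1 : y ∈ tightFace I l c P (tight I l c y) := ⟨hy, subset_rfl⟩
    rw [← closure_convexHull_extremePoints (hexp.isCompact h.compact) (hexp.convex h.convex)] at h1
    exact closure_minimal (convexHull_min hsub (hexp₀.convex h.convex))
      (hexp₀.isCompact h.compact).isClosed h1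
  exact hS₀ hy'.2

variable {S₀ : Finset ι} {g : E →L[ℝ] ℝ} {d : ℝ}

/-- On the face of `S₀` the form `g` attains its minimum at a vertex, so the whole face lies
strictly beyond the cutting hyperplane. -/
theorem not_subset_of_le (h : IsSimplePresentation I l c P)
    (hin : ∀ v ∈ P.extremePoints ℝ, v ∈ tightFace I l c P S₀ → d < g v)
    {x : E} (hx : x ∈ P) (hxd : g x ≤ d) : ¬S₀ ⊆ tight I l c x := by
  intro hsub
  obtain ⟨v, hv, hvF, hmax⟩ := h.exists_extremePoint_tightFace (S := S₀) ⟨x, hx, hsub⟩ (-g)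
  have h1 := hin v hv hvF
  have h2 := hmax x ⟨hx, hsub⟩
  simp only [neg_apply, neg_le_neg_iff] at h2
  linarith

variable [DecidableEq ι]

/-- A small move from `x` towards `y` shrinks the tight set to that of `y` and, by continuity, keeps
`g` below `e`. -/
theorem exists_tight_eq_combo (h : IsSimplePresentation I l c P) {x y : E} (hx : x ∈ P)
    (hy : y ∈ P) (hxy : tight I l c y ⊆ tight I l c x) {e : ℝ}
    (he : g x < e) : ∃ z ∈ P, tight I l c z = tight I l c y ∧ g z < e := by
  have hcont : Tendsto (fun ε : ℝ => g ((1 - ε) • x + ε • y)) (𝓝[>] 0) (𝓝 (g x)) := by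
    have : ContinuousAt (fun ε : ℝ => g ((1 - ε) • x + ε • y)) 0 := by fun_prop
    have h2 := this.tendsto.mono_left (nhdsWithin_le_nhds (s := Set.Ioi 0))
    simpa using h2
  have h1 := hcont.eventually_lt_const he
  have h2 : ∀ᶠ ε in 𝓝[>] (0 : ℝ), 0 < ε := eventually_mem_nhdsWithin
  have h3 : ∀ᶠ ε in 𝓝[>] (0 : ℝ), ε < 1 :=
    eventually_nhdsWithin_of_eventually_nhds (eventually_lt_nhds zero_lt_one)
  obtain ⟨ε, ⟨ha, hb⟩, hc⟩ := ((h1.and h2).and h3).exists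
  refine ⟨_, h.convex hx hy (by linarith) hb.le (by ring), ?_, ha⟩
  rw [h.tight_combo hx hy (by linarith) hb (by ring), Finset.inter_eq_right.2 hxy]

theorem exists_tight_eq_of_lt (h : IsSimplePresentation I l c P)
    (hout : ∀ v ∈ P.extremePoints ℝ, v ∉ tightFace I l c P S₀ → g v < d)
    {S : Finset ι} (hS : S ∈ dualComplex I l c P) (hS₀ : ¬S₀ ⊆ S) :
    ∃ y ∈ P, tight I l c y = S ∧ g y < d := by
  obtain ⟨v, hv, hvS, hv₀⟩ := h.exists_extremePoint_notMem hS hS₀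
  obtain ⟨y, hy, rfl⟩ := hS
  exact h.exists_tight_eq_combo hvS.1 hy hvS.2 (hout v hv hv₀)

/-- The relative interior of the face of `S` has points on both sides of the hyperplane: one below
by the previous lemma, one above near a vertex of the face of `S ∪ S₀`. The segment between them
meets the hyperplane without changing the tight set. -/
theorem exists_tight_eq_of_eq (h : IsSimplePresentation I l c P)
    (hin : ∀ v ∈ P.extremePoints ℝ, v ∈ tightFace I l c P S₀ → d < g v)
    (hout : ∀ v ∈ P.extremePoints ℝ, v ∉ tightFace I l c P S₀ → g v < d)
    {S : Finset ι} (hS : S ∪ S₀ ∈ dualComplex I l c P) (hS₀ : ¬S₀ ⊆ S) :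
    ∃ y ∈ P, tight I l c y = S ∧ g y = d := by
  have hS' := h.dualComplex_mono hS Finset.subset_union_left
  obtain ⟨y, hy, hty, hlt⟩ := h.exists_tight_eq_of_lt hout hS' hS₀
  obtain ⟨w, hw, htw⟩ := hS
  obtain ⟨v, hv, hvF, -⟩ := h.exists_extremePoint_tightFace (S := S ∪ S₀) ⟨w, hw, htw.ge⟩ g
  have hdv := hin v hv ⟨hvF.1, Finset.subset_union_right.trans hvF.2⟩
  obtain ⟨z, hz, htz, hgt⟩ := h.exists_tight_eq_combo (g := -g) (e := -d) hvF.1 hy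
    (hty.trans_subset (Finset.subset_union_left.trans hvF.2)) (by simpa using hdv)
  replace hgt : d < g z := by simpa using hgt
  have hpos : 0 < g z - g y := by linarith
  refine ⟨((g z - d) / (g z - g y)) • y + ((d - g y) / (g z - g y)) • z, ?_, ?_, ?_⟩
  · exact h.convex hy hz (div_nonneg (by linarith) hpos.le) (div_nonneg (by linarith) hpos.le)
      (by field_simp; ring)
  · rw [h.tight_combo hy hz (div_pos (by linarith) hpos) (div_pos (by linarith) hpos)
      (by field_simp; ring), htz, hty, Finset.inter_self]
  · simp only [map_add, map_smul, smul_eq_mul]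
    field_simp
    ring

/-- The maximum of `g` on the face of `x` is at least `d` and is attained at a vertex. Such a vertex
must be one that is cut off, so it lies on both faces. -/
theorem union_mem_dualComplex (h : IsSimplePresentation I l c P)
    (hout : ∀ v ∈ P.extremePoints ℝ, v ∉ tightFace I l c P S₀ → g v < d)
    {x : E} (hx : x ∈ P) (hxd : d ≤ g x) : tight I l c x ∪ S₀ ∈ dualComplex I l c P := by
  obtain ⟨v, hv, hvF, hmax⟩ := h.exists_extremePoint_tightFace (S := tight I l c x)
    ⟨x, hx, subset_rfl⟩ g
  have hv₀ : v ∈ tightFace I l c P S₀ := by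
    by_contra hcon
    linarith [hout v hv hcon, hmax x ⟨hx, subset_rfl⟩]
  exact h.dualComplex_mono ⟨v, hv.1, rfl⟩ (Finset.union_subset hvF.2 hv₀.2)

theorem tight_update {j : ι} (hj : j ∉ I) (x : E) :
    tight (insert j I) (Function.update l j g) (Function.update c j d) x =
      if g x = d then insert j (tight I l c x) else tight I l c x := by
  ext i
  by_cases hi : i = j
  · subst hi
    split_ifs with hd <;> simp [mem_tight, hd, hj]
  · split_ifs with hd <;> simp [mem_tight, hi]

/-- Truncating a simple polytope at a face is a stellar subdivision of the dual complex. -/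
theorem truncation (h : IsSimplePresentation I l c P) {Q : Set E} {j : ι} (hj : j ∉ I)
    (hS₀ : S₀ ⊆ I) (hQ : IsTruncation P (tightFace I l c P S₀) Q) :
    ∃ (l' : ι → E →L[ℝ] ℝ) (c' : ι → ℝ), (∀ i ∈ I, l' i = l i ∧ c' i = c i) ∧
      IsSimplePresentation (insert j I) l' c' Q ∧
      dualComplex (insert j I) l' c' Q = stellar S₀ j (dualComplex I l c P) := by
  obtain ⟨g, d, hin, hout, rfl⟩ := hQ
  have hjS₀ : j ∉ S₀ := fun hmem => hj (hS₀ hmem)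
  have hjt : ∀ x, j ∉ tight I l c x := fun x hmem => hj (mem_tight.1 hmem).1
  have hsub : ∀ {S : Finset ι}, S₀ ⊆ S ↔ S₀ ⊆ S.erase j := fun {S} =>
    (Finset.subset_erase.trans (and_iff_left hjS₀)).symm
  -- Simplices that contain `j` are realized on the cutting hyperplane, the others strictly below
  -- it.
  have key : ∀ S, (¬S₀ ⊆ S ∧ (if j ∈ S then S.erase j ∪ S₀ else S) ∈ dualComplex I l c P) →
      ∃ y ∈ {x ∈ P | g x ≤ d},
        tight (insert j I) (Function.update l j g) (Function.update c j d) y = S := by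
    rintro S ⟨h1, h2⟩
    split_ifs at h2 with hjS
    · obtain ⟨y, hy, hty, he⟩ := h.exists_tight_eq_of_eq hin hout h2 (fun h' => h1 (hsub.2 h'))
      refine ⟨y, ⟨hy, he.le⟩, ?_⟩
      rw [tight_update hj, if_pos he, hty, Finset.insert_erase hjS]
    · obtain ⟨y, hy, hty, hlt⟩ := h.exists_tight_eq_of_lt hout h2 h1
      refine ⟨y, ⟨hy, hlt.le⟩, ?_⟩
      rw [tight_update hj, if_neg hlt.ne, hty]
  -- Allowing all subsets of the tight set, not just the tight set itself, gives simplicity of `Q`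
  -- together with the description of its complex.
  have key' : ∀ x ∈ {x ∈ P | g x ≤ d},
      ∀ S ⊆ tight (insert j I) (Function.update l j g) (Function.update c j d) x,
      ¬S₀ ⊆ S ∧ (if j ∈ S then S.erase j ∪ S₀ else S) ∈ dualComplex I l c P := by
    rintro x ⟨hx, hxd⟩ S hS
    rw [tight_update hj] at hS
    have hS' : S.erase j ⊆ tight I l c x := by
      intro i hi
      have h1 := hS (Finset.mem_of_mem_erase hi)
      split_ifs at h1
      · exact (Finset.mem_insert.1 h1).resolve_left (Finset.ne_of_mem_erase hi)
      · exact h1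
    refine ⟨fun hcon => h.not_subset_of_le hin hx hxd ((hsub.1 hcon).trans hS'), ?_⟩
    split_ifs with hjS
    · have he : g x = d := by
        by_contra hne
        rw [if_neg hne] at hS
        exact hjt x (hS hjS)
      exact h.dualComplex_mono (h.union_mem_dualComplex hout hx he.ge)
        (Finset.union_subset_union_left hS')
    · rw [Finset.erase_eq_of_notMem hjS] at hS'
      exact h.dualComplex_mono ⟨x, hx, rfl⟩ hS'
  refine ⟨Function.update l j g, Function.update c j d, ?_, ⟨?_, ?_, ?_⟩, ?_⟩
  · intro i hi
    have : i ≠ j := fun he => hj (he ▸ hi)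
    simp [this]
  · ext x
    simp only [Set.mem_ofPred_eq, Finset.forall_mem_insert, Function.update_self, h.mem_iff]
    rw [and_comm]
    refine and_congr_right fun _ => forall₂_congr fun i hi => ?_
    have : i ≠ j := fun he => hj (he ▸ hi)
    simp [this]
  · exact h.compact.inter_right (isClosed_le g.continuous continuous_const)
  · intro x hx S hS
    exact key S (key' x hx S hS)
  · ext S
    constructor
    · rintro ⟨y, hy, rfl⟩
      exact key' y hy _ subset_rfl
    · exact key S

end IsSimplePresentation

end Truncation

/-! ### The cube and its iterated truncations -/

section Cubeahedra

variable {V : Type*}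

/-- Labels for the facets of a cube truncated at faces of the form `x_v = 0` for all `v ∈ t`. -/
inductive Facet (V : Type*)
  | zero (v : V)
  | one (v : V)
  | tube (t : Finset V)
  deriving DecidableEq

theorem Facet.zero_injective : Function.Injective (Facet.zero : V → Facet V) :=
  fun _ _ h => Facet.zero.inj h

/-- The set of the facets `x_v = 0`, `v ∈ t`. -/
def zeros (t : Finset V) : Finset (Facet V) :=
  t.map ⟨Facet.zero, Facet.zero_injective⟩

@[simp]
theorem mem_zeros {t : Finset V} {f : Facet V} : f ∈ zeros t ↔ ∃ v ∈ t, Facet.zero v = f := by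
  simp [zeros]

theorem zeros_subset {t : Finset V} {S : Finset (Facet V)} :
    zeros t ⊆ S ↔ ∀ v ∈ t, Facet.zero v ∈ S := by
  simp [zeros, Finset.subset_iff]

section Presentation

variable [Fintype V]

/-- `P` is presented by constraints labelled by facets, among them `x_v ≥ 0` for all nodes `v`. -/
structure IsCubePresentation (I : Finset (Facet V)) (l : Facet V → (V → ℝ) →L[ℝ] ℝ)
    (c : Facet V → ℝ) (P : Set (V → ℝ)) : Prop where
  simple : IsSimplePresentation I l c P
  zero_mem : ∀ v, Facet.zero v ∈ I
  zero_eq : ∀ v, l (.zero v) = -ContinuousLinearMap.proj v ∧ c (.zero v) = 0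

theorem IsCubePresentation.tightFace_zeros {I : Finset (Facet V)}
    {l : Facet V → (V → ℝ) →L[ℝ] ℝ} {c : Facet V → ℝ} {P : Set (V → ℝ)}
    (h : IsCubePresentation I l c P) (t : Finset V) :
    tightFace I l c P (zeros t) = {x ∈ P | ∀ v ∈ t, x v = 0} := by
  ext x
  refine and_congr_right fun _ => ?_
  rw [zeros_subset]
  refine forall₂_congr fun v _ => ?_
  simp [mem_tight, h.zero_mem v, h.zero_eq v]

variable [DecidableEq V]

/-- The labels of the facets of the cube. -/
def cubeFacets (V : Type*) [Fintype V] [DecidableEq V] : Finset (Facet V) :=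
  Finset.univ.image .zero ∪ Finset.univ.image .one

/-- The dual complex of the cube. -/
def cubeComplex (V : Type*) : Set (Finset (Facet V)) :=
  {S | (∀ t, .tube t ∉ S) ∧ ∀ v, .one v ∈ S → .zero v ∉ S}

/-- The linear forms in the constraints that define the cube. -/
noncomputable def cubeForm : Facet V → (V → ℝ) →L[ℝ] ℝ
  | .zero v => -ContinuousLinearMap.proj v
  | .one v => ContinuousLinearMap.proj v
  | .tube _ => 0

/-- The right-hand sides of the constraints that define the cube. -/
def cubeBound : Facet V → ℝ
  | .zero _ => 0
  | .one _ => 1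
  | .tube _ => 0

theorem zero_mem_cubeFacets (v : V) : Facet.zero v ∈ cubeFacets V := by simp [cubeFacets]

theorem one_mem_cubeFacets (v : V) : Facet.one v ∈ cubeFacets V := by simp [cubeFacets]

theorem tube_notMem_cubeFacets (t : Finset V) : Facet.tube t ∉ cubeFacets V := by
  simp [cubeFacets]

theorem mem_cube_iff {x : V → ℝ} :
    x ∈ Set.Icc (0 : V → ℝ) 1 ↔ ∀ i ∈ cubeFacets V, cubeForm i x ≤ cubeBound i := by
  constructor
  · rintro ⟨h0, h1⟩ i hi
    cases i with
    | zero v => simpa [cubeForm, cubeBound] using h0 v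
    | one v => simpa [cubeForm, cubeBound] using h1 v
    | tube t => exact absurd hi (tube_notMem_cubeFacets t)
  · intro h
    exact ⟨fun v => by simpa [cubeForm, cubeBound] using h _ (zero_mem_cubeFacets v),
      fun v => by simpa [cubeForm, cubeBound] using h _ (one_mem_cubeFacets v)⟩

theorem zero_mem_tight_cube {x : V → ℝ} {v : V} :
    Facet.zero v ∈ tight (cubeFacets V) cubeForm cubeBound x ↔ x v = 0 := by
  simp [mem_tight, zero_mem_cubeFacets, cubeForm, cubeBound]

theorem one_mem_tight_cube {x : V → ℝ} {v : V} :
    Facet.one v ∈ tight (cubeFacets V) cubeForm cubeBound x ↔ x v = 1 := by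
  simp [mem_tight, one_mem_cubeFacets, cubeForm, cubeBound]

theorem tube_notMem_tight_cube {x : V → ℝ} {t : Finset V} :
    Facet.tube t ∉ tight (cubeFacets V) cubeForm cubeBound x := by
  simp [mem_tight, tube_notMem_cubeFacets]

theorem exists_tight_cube_eq {S : Finset (Facet V)} (hS : S ∈ cubeComplex V) :
    ∃ y ∈ Set.Icc (0 : V → ℝ) 1, tight (cubeFacets V) cubeForm cubeBound y = S := by
  -- The value 1/2 leaves both constraints of a coordinate slack.
  refine ⟨fun v => if .zero v ∈ S then 0 else if .one v ∈ S then 1 else 1 / 2,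
    ⟨fun v => ?_, fun v => ?_⟩, ?_⟩
  · simp only [Pi.zero_apply]
    split_ifs <;> norm_num
  · simp only [Pi.one_apply]
    split_ifs <;> norm_num
  · ext i
    cases i with
    | zero v =>
      rw [zero_mem_tight_cube]
      split_ifs with h1 h2 <;> simp [h1]
    | one v =>
      rw [one_mem_tight_cube]
      split_ifs with h1 h2
      · simpa using fun h => hS.2 v h h1
      · simp [h2]
      · norm_num [h2]
    | tube t => simp [hS.1 t, tube_notMem_tight_cube]

theorem tight_cube_mem (x : V → ℝ) :
    tight (cubeFacets V) cubeForm cubeBound x ∈ cubeComplex V := by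
  refine ⟨fun t => tube_notMem_tight_cube, fun v h1 h0 => ?_⟩
  rw [one_mem_tight_cube] at h1
  rw [zero_mem_tight_cube] at h0
  linarith

theorem isCubePresentation_cube :
    IsCubePresentation (cubeFacets V) cubeForm cubeBound (Set.Icc (0 : V → ℝ) 1) where
  simple :=
    { eq := Set.ext fun _ => mem_cube_iff
      compact := isCompact_Icc
      exists_tight_eq := fun x _ _ hS => exists_tight_cube_eq
        ⟨fun t ht => (tight_cube_mem x).1 t (hS ht),
          fun v h1 h0 => (tight_cube_mem x).2 v (hS h1) (hS h0)⟩ }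
  zero_mem := zero_mem_cubeFacets
  zero_eq _ := ⟨rfl, rfl⟩

theorem dualComplex_cube :
    dualComplex (cubeFacets V) cubeForm cubeBound (Set.Icc (0 : V → ℝ) 1) = cubeComplex V := by
  ext S
  constructor
  · rintro ⟨y, -, rfl⟩
    exact tight_cube_mem y
  · exact exists_tight_cube_eq

/-- The dual complex after truncating the faces of the sets of nodes in a list. -/
def subdivide (ts : List (Finset V)) (Δ : Set (Finset (Facet V))) : Set (Finset (Facet V)) :=
  ts.foldl (fun Δ t => stellar (zeros t) (.tube t) Δ) Δ

/-- The constraints `x_v ≥ 0` survive every cut, so each face to be truncated is again a `tightFace`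
of zeros. Distinct tubes supply fresh labels for the new facets. -/
theorem IsCubePresentation.iteratedTruncation {ts : List (Finset V)} {P R : Set (V → ℝ)}
    (hR : IteratedTruncation ts P R) {I : Finset (Facet V)} {l : Facet V → (V → ℝ) →L[ℝ] ℝ}
    {c : Facet V → ℝ} (h : IsCubePresentation I l c P) (hts : ∀ t ∈ ts, .tube t ∉ I)
    (hnd : ts.Nodup) :
    ∃ I' l' c', IsCubePresentation I' l' c' R ∧
      dualComplex I' l' c' R = subdivide ts (dualComplex I l c P) := by
  induction hR generalizing I l c with
  | nil P => exact ⟨I, l, c, h, rfl⟩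
  | cons t ts P Q R hQ hR ih =>
    rw [← h.tightFace_zeros] at hQ
    have hz : zeros t ⊆ I := zeros_subset.2 fun v _ => h.zero_mem v
    obtain ⟨l', c', heq, hs, hdual⟩ := h.simple.truncation (hts t List.mem_cons_self) hz hQ
    have h' : IsCubePresentation (insert (.tube t) I) l' c' Q :=
      ⟨hs, fun v => Finset.mem_insert_of_mem (h.zero_mem v), fun v => by
        rw [(heq _ (h.zero_mem v)).1, (heq _ (h.zero_mem v)).2]
        exact h.zero_eq v⟩
    obtain ⟨I'', l'', c'', hc, hd⟩ := ih h' (fun t' ht' hmem => by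
      rcases Finset.mem_insert.1 hmem with he | hmem
      · rw [Facet.tube.injEq] at he
        exact (List.nodup_cons.1 hnd).1 (he ▸ ht')
      · exact hts t' (List.mem_cons_of_mem _ ht') hmem) (List.nodup_cons.1 hnd).2
    exact ⟨I'', l'', c'', hc, by rw [hd, hdual]; rfl⟩

theorem IsCubePresentation.exists_iteratedTruncation (ts : List (Finset V)) {P : Set (V → ℝ)}
    {I : Finset (Facet V)} {l : Facet V → (V → ℝ) →L[ℝ] ℝ}
    {c : Facet V → ℝ} (h : IsCubePresentation I l c P) (hts : ∀ t ∈ ts, .tube t ∉ I)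
    (hnd : ts.Nodup) : ∃ R, IteratedTruncation ts P R := by
  induction ts generalizing I l c P with
  | nil => exact ⟨P, .nil P⟩
  | cons t ts ih =>
    -- On `P` this form is zero exactly on the face to be cut off and negative elsewhere. A suitable
    -- `d` is negative but above the finitely many values at the other vertices.
    let g : (V → ℝ) →L[ℝ] ℝ := -∑ v ∈ t, ContinuousLinearMap.proj v
    have hg : ∀ x, g x = -∑ v ∈ t, x v := fun x => by simp [g]
    have hnonneg : ∀ x ∈ P, ∀ v, 0 ≤ x v := fun x hx v => by
      have := h.simple.mem_iff.1 hx _ (h.zero_mem v)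
      rw [(h.zero_eq v).1, (h.zero_eq v).2] at this
      simpa using this
    have hneg : ∀ x ∈ P, x ∉ {x ∈ P | ∀ v ∈ t, x v = 0} → g x < 0 := fun x hx hxF => by
      rw [hg, neg_lt_zero]
      refine lt_of_le_of_ne (Finset.sum_nonneg fun v _ => hnonneg x hx v) fun he => hxF ⟨hx, ?_⟩
      exact (Finset.sum_eq_zero_iff_of_nonneg fun v _ => hnonneg x hx v).1 he.symm
    obtain ⟨d, hd0, hd⟩ : ∃ d < 0, ∀ v ∈ P.extremePoints ℝ,
        v ∉ {x ∈ P | ∀ v ∈ t, x v = 0} → g v < d := by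
      have hfin : {v ∈ P.extremePoints ℝ | v ∉ {x ∈ P | ∀ v ∈ t, x v = 0}}.Finite :=
        h.simple.finite_extremePoints.subset (Set.sep_subset _ _)
      have := (hfin.eventually_all (l := nhdsWithin (0 : ℝ) (Set.Iio 0))
        (p := fun v d => g v < d)).2 fun v hv =>
        eventually_nhdsWithin_of_eventually_nhds (eventually_gt_nhds (hneg v hv.1.1 hv.2))
      obtain ⟨d, h1, h2⟩ := (this.and eventually_mem_nhdsWithin).exists
      exact ⟨d, h2, fun v hv hvF => h1 v ⟨hv, hvF⟩⟩
    have hQ : IsTruncation P {x ∈ P | ∀ v ∈ t, x v = 0} {x ∈ P | g x ≤ d} :=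
      ⟨g, d, fun v _ hvF => by rw [hg, Finset.sum_eq_zero hvF.2]; simpa using hd0, hd, rfl⟩
    have hQ' := hQ
    rw [← h.tightFace_zeros] at hQ'
    have hz : zeros t ⊆ I := zeros_subset.2 fun v _ => h.zero_mem v
    obtain ⟨l', c', heq, hs, -⟩ := h.simple.truncation (hts t List.mem_cons_self) hz hQ'
    have h' : IsCubePresentation (insert (.tube t) I) l' c' {x ∈ P | g x ≤ d} :=
      ⟨hs, fun v => Finset.mem_insert_of_mem (h.zero_mem v), fun v => by
        rw [(heq _ (h.zero_mem v)).1, (heq _ (h.zero_mem v)).2]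
        exact h.zero_eq v⟩
    obtain ⟨R, hR⟩ := ih h' (fun t' ht' hmem => by
      rcases Finset.mem_insert.1 hmem with he | hmem
      · rw [Facet.tube.injEq] at he
        exact (List.nodup_cons.1 hnd).1 (he ▸ ht')
      · exact hts t' (List.mem_cons_of_mem _ ht') hmem) (List.nodup_cons.1 hnd).2
    exact ⟨R, .cons t ts P _ R hQ hR⟩

end Presentation

end Cubeahedra

/-! ### Design tubings as the simplices of the subdivided cube complex -/

section Tubings

variable {V : Type*}

theorem isRoundTube_singleton (G : SimpleGraph V) (v : V) : IsRoundTube G {v} := by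
  rw [IsRoundTube, SimpleGraph.connected_iff_exists_forall_reachable]
  refine ⟨⟨v, by simp⟩, ?_⟩
  rintro ⟨w, hw⟩
  obtain rfl : w = v := by simpa using hw
  exact SimpleGraph.Reachable.refl _

theorem IsRoundTube.nonempty {G : SimpleGraph V} {t : Finset V} (ht : IsRoundTube G t) :
    t.Nonempty := by
  obtain ⟨v, hv⟩ := SimpleGraph.Connected.nonempty ht
  exact ⟨v, hv⟩

theorem IsRoundTube.exists_adj {G : SimpleGraph V} {t : Finset V} (ht : IsRoundTube G t)
    (A : Set V) {a b : V} (ha : a ∈ t) (haA : a ∈ A) (hb : b ∈ t) (hbA : b ∉ A) :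
    ∃ u ∈ t, ∃ w ∈ t, u ∈ A ∧ w ∉ A ∧ G.Adj u w := by
  obtain ⟨p⟩ := ht.preconnected ⟨a, ha⟩ ⟨b, hb⟩
  obtain ⟨d, -, h1, h2⟩ := p.exists_boundary_dart (Subtype.val ⁻¹' A) haA hbA
  exact ⟨d.fst, d.fst.2, d.snd, d.snd.2, h1, h2, d.adj⟩

variable [DecidableEq V]

/-- The simplex of the cube complex obtained by replacing every tube in the list by its nodes. -/
def collapse : List (Finset V) → Finset (Facet V) → Finset (Facet V)
  | [], S => S
  -- Subdivisions are undone starting with the last one, so the tail is collapsed before its head.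
  | t :: ts, S =>
    if .tube t ∈ collapse ts S then (collapse ts S).erase (.tube t) ∪ zeros t else collapse ts S

/-- This unfolds the stellar conditions backwards. When `t` is truncated, only the later tubes `B`
have yet to be introduced, so what must not contain the zeros of `t` is `S` with just those tubes
undone. -/
theorem mem_subdivide {ts : List (Finset V)} {Δ : Set (Finset (Facet V))}
    {S : Finset (Facet V)} :
    S ∈ subdivide ts Δ ↔ collapse ts S ∈ Δ ∧
      ∀ A t B, ts = A ++ t :: B → ¬zeros t ⊆ collapse B S := by
  induction ts generalizing Δ with
  | nil => simp [subdivide, collapse]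
  | cons t ts ih =>
    have : subdivide (t :: ts) Δ = subdivide ts (stellar (zeros t) (.tube t) Δ) := rfl
    rw [this, ih]
    constructor
    · rintro ⟨⟨h1, h2⟩, h3⟩
      refine ⟨h2, fun A t' B he => ?_⟩
      cases A with
      | nil =>
        obtain ⟨rfl, rfl⟩ := List.cons.inj he
        exact h1
      | cons a A =>
        obtain ⟨rfl, rfl⟩ := List.cons.inj he
        exact h3 A t' B rfl
    · rintro ⟨h1, h2⟩
      exact ⟨⟨h2 [] t ts rfl, h1⟩, fun A t' B he => h2 (t :: A) t' B (by rw [he]; rfl)⟩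

theorem one_mem_collapse {ts : List (Finset V)} {S : Finset (Facet V)} {v : V} :
    .one v ∈ collapse ts S ↔ .one v ∈ S := by
  induction ts with
  | nil => rfl
  | cons t ts ih =>
    rw [collapse]
    split_ifs <;> simp [ih]

theorem tube_mem_collapse {ts : List (Finset V)} {S : Finset (Facet V)} {t : Finset V} :
    .tube t ∈ collapse ts S ↔ .tube t ∈ S ∧ t ∉ ts := by
  induction ts with
  | nil => simp [collapse]
  | cons t' ts ih =>
    rw [collapse]
    by_cases he : t = t'
    · subst he
      split_ifs with h
      · simp
      · simp [h]
    · split_ifs <;> simp [ih, he]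

theorem zero_mem_collapse {ts : List (Finset V)} {S : Finset (Facet V)} {v : V}
    (hts : ts.Nodup) :
    .zero v ∈ collapse ts S ↔ .zero v ∈ S ∨ ∃ t ∈ ts, .tube t ∈ S ∧ v ∈ t := by
  induction ts with
  | nil => simp [collapse]
  | cons t ts ih =>
    rw [List.nodup_cons] at hts
    have hmem : .tube t ∈ collapse ts S ↔ .tube t ∈ S := by simp [tube_mem_collapse, hts.1]
    simp only [collapse, hmem]
    split_ifs with h
    · simp [ih hts.2, h, or_assoc, or_comm (a := v ∈ t)]
    · simp [ih hts.2, h]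

/-- The design tubings of a graph: sets of round tubes, any two of them nested or far apart, and
of square tubes, which do not lie in the round ones. -/
structure IsDesignTubing (G : SimpleGraph V) (S : Finset (Facet V)) : Prop where
  zero_notMem : ∀ v, .zero v ∉ S
  isRoundTube : ∀ t, .tube t ∈ S → IsRoundTube G t
  compatible : ∀ t t', .tube t ∈ S → .tube t' ∈ S →
    t ⊆ t' ∨ t' ⊆ t ∨ ¬IsRoundTube G (t ∪ t')
  notMem : ∀ v t, .one v ∈ S → .tube t ∈ S → v ∉ t

theorem isDesignTubing_empty (G : SimpleGraph V) : IsDesignTubing G ∅ := by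
  constructor <;> simp

theorem IsRoundTube.union {G : SimpleGraph V} {s t : Finset V} (hs : IsRoundTube G s)
    (ht : IsRoundTube G t) {u w : V} (hu : u ∈ s) (hw : w ∈ t) (h : G.Adj u w) :
    IsRoundTube G (s ∪ t) := by
  rw [IsRoundTube, Finset.coe_union]
  exact SimpleGraph.connected_induce_union hs.preconnected ht.preconnected
    (Finset.mem_coe.2 hu) (Finset.mem_coe.2 hw) h

/-- The order of truncation is essential: when a round tube is cut, exactly tubes of no larger size
are still to come. A simplex is excluded when tubes that come later cover an earlier one, and this
amounts to two non-nested tubes with connected union. -/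
theorem mem_subdivide_cubeComplex {G : SimpleGraph V} {ts : List (Finset V)} (hnd : ts.Nodup)
    (hts : ∀ t, t ∈ ts ↔ IsRoundTube G t)
    (hcard : ts.Pairwise fun s t => t.card ≤ s.card) {S : Finset (Facet V)} :
    S ∈ subdivide ts (cubeComplex V) ↔ IsDesignTubing G S := by
  rw [mem_subdivide]
  have hsplit : ∀ A t B, ts = A ++ t :: B →
      B.Nodup ∧ t ∉ B ∧ (∀ t' ∈ B, t'.card ≤ t.card) ∧ ∀ t' ∈ A, t.card ≤ t'.card := by
    rintro A t B rfl
    rw [List.pairwise_append, List.pairwise_cons] at hcard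
    have h := List.nodup_cons.1 (List.nodup_append.1 hnd).2.1
    exact ⟨h.2, h.1, hcard.2.1.1, fun t' ht' => hcard.2.2 t' ht' t List.mem_cons_self⟩
  constructor
  · rintro ⟨⟨h1, h2⟩, h3⟩
    have hround : ∀ t, .tube t ∈ S → IsRoundTube G t := fun t ht => by
      by_contra hcon
      exact h1 t (tube_mem_collapse.2 ⟨ht, fun h => hcon ((hts t).1 h)⟩)
    refine ⟨fun v hv => ?_, hround, fun t t' ht ht' => ?_, fun v t hv ht hvt => ?_⟩
    -- A single node is a round tube, so the facet `x_v = 0` is itself truncated and its label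
    -- replaced.
    · obtain ⟨A, B, he⟩ := List.append_of_mem ((hts {v}).2 (isRoundTube_singleton G v))
      refine h3 A _ B he (zeros_subset.2 fun w hw => ?_)
      rw [Finset.mem_singleton.1 hw]
      exact (zero_mem_collapse (hsplit A _ B he).1).2 (Or.inl hv)
    · by_contra! hcon
      obtain ⟨hn, hn', hr⟩ := hcon
      obtain ⟨A, B, he⟩ := List.append_of_mem ((hts _).2 hr)
      obtain ⟨hB, -, -, hA⟩ := hsplit A _ B he
      -- Both tubes are strictly smaller than their union, hence come after it and cover it at its
      -- turn.
      have hlt : t.card < (t ∪ t').card := Finset.card_lt_card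
        ⟨Finset.subset_union_left, fun h => hn' (Finset.subset_union_right.trans h)⟩
      have hlt' : t'.card < (t ∪ t').card := Finset.card_lt_card
        ⟨Finset.subset_union_right, fun h => hn (Finset.subset_union_left.trans h)⟩
      have hmem : ∀ s, .tube s ∈ S → s.card < (t ∪ t').card → s ∈ B := fun s hs hlt => by
        have := (hts s).2 (hround s hs)
        rw [he, List.mem_append, List.mem_cons] at this
        rcases this with h | h | h
        · exact absurd (hA s h) (not_le.2 hlt)
        · rw [h] at hlt
          exact absurd hlt (lt_irrefl _)
        · exact h
      refine h3 A _ B he (zeros_subset.2 fun w hw => (zero_mem_collapse hB).2 (Or.inr ?_))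
      rcases Finset.mem_union.1 hw with hw | hw
      · exact ⟨t, hmem t ht hlt, ht, hw⟩
      · exact ⟨t', hmem t' ht' hlt', ht', hw⟩
    · exact h2 v (one_mem_collapse.2 hv)
        ((zero_mem_collapse hnd).2 (Or.inr ⟨t, (hts t).2 (hround t ht), ht, hvt⟩))
  · intro h
    refine ⟨⟨fun t ht => ?_, fun v hv hv0 => ?_⟩, fun A t B he hsub => ?_⟩
    · obtain ⟨h1, h2⟩ := tube_mem_collapse.1 ht
      exact h2 ((hts t).2 (h.isRoundTube t h1))
    · rcases (zero_mem_collapse hnd).1 hv0 with h0 | ⟨t, -, ht, hvt⟩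
      · exact h.zero_notMem v h0
      · exact h.notMem v t (one_mem_collapse.1 hv) ht hvt
    · obtain ⟨hB, htB, hcB, -⟩ := hsplit A t B he
      have hcov : ∀ v ∈ t, ∃ t' ∈ B, .tube t' ∈ S ∧ v ∈ t' := fun v hv =>
        ((zero_mem_collapse hB).1 (zeros_subset.1 hsub v hv)).resolve_left (h.zero_notMem v)
      have ht : IsRoundTube G t := (hts t).1 (he ▸ by simp)
      obtain ⟨v, hv⟩ := ht.nonempty
      obtain ⟨t₀, ht₀B, ht₀S, hvt₀⟩ := hcov v hv
      -- Take a largest tube of `S` among the later ones that meet `t`. It cannot contain `t`, so an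
      -- edge of `t` leaves it; the tube covering the other end is compatible with `t₁` only if it
      -- is larger, against maximality.
      obtain ⟨t₁, ht₁, hmax⟩ := Finset.exists_max_image
        (B.toFinset.filter fun t' => .tube t' ∈ S ∧ (t ∩ t').Nonempty) Finset.card
        ⟨t₀, by simpa [ht₀B, ht₀S] using ⟨v, Finset.mem_inter.2 ⟨hv, hvt₀⟩⟩⟩
      simp only [Finset.mem_filter, List.mem_toFinset] at ht₁ hmax
      obtain ⟨ht₁B, ht₁S, a, ha⟩ := ht₁
      rw [Finset.mem_inter] at ha
      by_cases hsub' : t ⊆ t₁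
      · exact htB (Finset.eq_of_subset_of_card_le hsub' (hcB _ ht₁B) ▸ ht₁B)
      · obtain ⟨b, hb, hb₁⟩ := Finset.not_subset.1 hsub'
        obtain ⟨u, -, w, hw, hu₁, hw₁, hadj⟩ :=
          ht.exists_adj (t₁ : Set V) ha.1 ha.2 hb (by simpa using hb₁)
        rw [Finset.mem_coe] at hu₁ hw₁
        obtain ⟨t₂, ht₂B, ht₂S, hw₂⟩ := hcov w hw
        rcases h.compatible t₁ t₂ ht₁S ht₂S with hn | hn | hn
        · have hlt : t₁.card < t₂.card := Finset.card_lt_card ⟨hn, fun h => hw₁ (h hw₂)⟩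
          exact absurd (hmax t₂ ⟨ht₂B, ht₂S, w, Finset.mem_inter.2 ⟨hw, hw₂⟩⟩) (not_le.2 hlt)
        · exact hw₁ (hn hw₂)
        · exact hn ((h.isRoundTube t₁ ht₁S).union (h.isRoundTube t₂ ht₂S) hu₁ hw₂ hadj)

variable [Fintype V]

theorem exists_isGraphCubeahedron (G : SimpleGraph V) :
    ∃ C : Set (V → ℝ), IsGraphCubeahedron G C := by
  classical
  let ts := (Finset.univ.filter fun t : Finset V => IsRoundTube G t).toList.mergeSort
    fun s t => decide (t.card ≤ s.card)
  have hnd : ts.Nodup := (List.mergeSort_perm _ _).nodup_iff.2 (Finset.nodup_toList _)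
  obtain ⟨C, hC⟩ := isCubePresentation_cube.exists_iteratedTruncation ts
    (fun t _ => tube_notMem_cubeFacets t) hnd
  refine ⟨C, ts, hnd, fun t => by simp [ts], ?_, hC⟩
  have := List.pairwise_mergeSort (le := fun s t : Finset V => decide (t.card ≤ s.card))
    (fun a b c hab hbc => by simp only [decide_eq_true_eq] at *; omega)
    (fun a b => by simp only [Bool.or_eq_true, decide_eq_true_eq]; omega)
    (Finset.univ.filter fun t : Finset V => IsRoundTube G t).toList
  simpa using this

/-- A graph cubeahedron is a full-dimensional simple polytope whose dual complex is the complex of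
design tubings. -/
theorem IsGraphCubeahedron.exists_presentation {G : SimpleGraph V} {C : Set (V → ℝ)}
    (h : IsGraphCubeahedron G C) :
    ∃ I l c, IsSimplePresentation I l c C ∧ dualComplex I l c C = {S | IsDesignTubing G S} := by
  obtain ⟨ts, hnd, hts, hcard, hC⟩ := h
  obtain ⟨I, l, c, hs, hd⟩ := isCubePresentation_cube.iteratedTruncation hC
    (fun t _ => tube_notMem_cubeFacets t) hnd
  refine ⟨I, l, c, hs.simple, ?_⟩
  rw [hd, dualComplex_cube]
  exact Set.ext fun S => mem_subdivide_cubeComplex hnd hts hcard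

theorem IsGraphCubeahedron.isConvexPolytope {G : SimpleGraph V} {C : Set (V → ℝ)}
    (h : IsGraphCubeahedron G C) : IsConvexPolytope C := by
  obtain ⟨I, l, c, hs, hd⟩ := h.exists_presentation
  have h0 : ∅ ∈ dualComplex I l c C := hd ▸ isDesignTubing_empty G
  obtain ⟨y, hy, -⟩ := h0
  exact hs.isConvexPolytope ⟨y, hy⟩

theorem IsGraphCubeahedron.hasDim {G : SimpleGraph V} {C : Set (V → ℝ)}
    (h : IsGraphCubeahedron G C) : HasDim C (Fintype.card V) := by
  obtain ⟨I, l, c, hs, hd⟩ := h.exists_presentation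
  have h0 : ∅ ∈ dualComplex I l c C := hd ▸ isDesignTubing_empty G
  simpa using hs.hasDim h0

theorem IsGraphCubeahedron.nonempty_orderIso {G : SimpleGraph V} {C : Set (V → ℝ)}
    (h : IsGraphCubeahedron G C) :
    Nonempty ((↥{S : Finset (Facet V) | IsDesignTubing G S})ᵒᵈ ≃o FacePoset C) := by
  obtain ⟨I, l, c, hs, hd⟩ := h.exists_presentation
  rw [← hd]
  exact ⟨hs.facePosetIso⟩

end Tubings

/-! ### Tubings of a path are bracketings -/

section PathGraph

variable {m : ℕ}

theorem isRoundTube_Icc {a b : Fin m} (hab : a ≤ b) :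
    IsRoundTube (SimpleGraph.pathGraph m) (Finset.Icc a b) := by
  obtain ⟨k, hk⟩ : ∃ k, b.val = a.val + k := Nat.exists_eq_add_of_le hab
  induction k generalizing b with
  | zero =>
    obtain rfl : a = b := Fin.ext (by omega)
    simpa using isRoundTube_singleton _ a
  | succ k ih =>
    have hlt := b.isLt
    have hle : a ≤ (⟨a.val + k, by omega⟩ : Fin m) := Fin.le_def.2 (by simp)
    have h := (ih hle rfl).union (isRoundTube_singleton (SimpleGraph.pathGraph m) b)
      (Finset.right_mem_Icc.2 hle) (Finset.mem_singleton_self b)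
      (SimpleGraph.pathGraph_adj.2 (Or.inl (by simp only; omega)))
    convert h using 1
    ext x
    simp only [Finset.mem_union, Finset.mem_Icc, Finset.mem_singleton, Fin.le_def, Fin.ext_iff]
    omega

theorem IsRoundTube.exists_eq_Icc {t : Finset (Fin m)}
    (ht : IsRoundTube (SimpleGraph.pathGraph m) t) : ∃ a b, a ≤ b ∧ t = Finset.Icc a b := by
  have hne := ht.nonempty
  refine ⟨t.min' hne, t.max' hne, t.min'_le_max' hne, ?_⟩
  ext c
  rw [Finset.mem_Icc]
  refine ⟨fun hc => ⟨t.min'_le c hc, t.le_max' c hc⟩, fun ⟨h1, h2⟩ => ?_⟩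
  by_contra hc
  have h1' : t.min' hne < c := lt_of_le_of_ne h1 fun he => hc (he ▸ t.min'_mem hne)
  -- An edge of the path that leaves the nodes below `c` ends at `c`, which is missing from `t`.
  obtain ⟨u, hu, w, hw, hu', hw', hadj⟩ := ht.exists_adj (Set.Iio c) (t.min'_mem hne) h1'
    (t.max'_mem hne) (not_lt.2 h2)
  have hwc : w ≠ c := fun he => hc (he ▸ hw)
  rw [SimpleGraph.pathGraph_adj] at hadj
  simp only [Set.mem_Iio, Fin.lt_def] at hu' hw'
  rw [ne_eq, Fin.ext_iff] at hwc
  omega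

/-- The inequalities say that no node is left between the two intervals. If one were, it would lie
in the interval spanned by the union but not in the union. -/
theorem isRoundTube_Icc_union_Icc {a b a' b' : Fin m} (hab : a ≤ b) (hab' : a' ≤ b')
    (h : ¬(Finset.Icc a b ⊆ Finset.Icc a' b')) (h' : ¬(Finset.Icc a' b' ⊆ Finset.Icc a b)) :
    IsRoundTube (SimpleGraph.pathGraph m) (Finset.Icc a b ∪ Finset.Icc a' b') ↔
      a'.val ≤ b.val + 1 ∧ a.val ≤ b'.val + 1 := by
  rw [Finset.Icc_subset_Icc_iff hab] at h
  rw [Finset.Icc_subset_Icc_iff hab'] at h'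
  rw [Fin.le_def, Fin.le_def] at h h'
  rw [Fin.le_def] at hab hab'
  constructor
  · intro hr
    obtain ⟨x, y, hxy, he⟩ := hr.exists_eq_Icc
    have key : ∀ z : Fin m, ((a.val ≤ z.val ∧ z.val ≤ b.val) ∨ (a'.val ≤ z.val ∧ z.val ≤ b'.val)) ↔
        (x.val ≤ z.val ∧ z.val ≤ y.val) := fun z => by
      have := Finset.ext_iff.1 he z
      simpa only [Finset.mem_union, Finset.mem_Icc, Fin.le_def] using this
    have h1 := key a
    have h2 := key b
    have h3 := key a'
    have h4 := key b'
    constructor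
    · by_contra hcon
      have h5 := key ⟨b.val + 1, by omega⟩
      simp only at h5
      omega
    · by_contra hcon
      have h5 := key ⟨b'.val + 1, by omega⟩
      simp only at h5
      omega
  · intro hc
    obtain ⟨x, y, hxy, he⟩ : ∃ x y : Fin m, x ≤ y ∧
        Finset.Icc a b ∪ Finset.Icc a' b' = Finset.Icc x y := by
      by_cases hlt : a.val ≤ a'.val
      · refine ⟨a, b', Fin.le_def.2 (by omega), ?_⟩
        ext z
        simp only [Finset.mem_union, Finset.mem_Icc, Fin.le_def]
        omega
      · refine ⟨a', b, Fin.le_def.2 (by omega), ?_⟩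
        ext z
        simp only [Finset.mem_union, Finset.mem_Icc, Fin.le_def]
        omega
    rw [he]
    exact isRoundTube_Icc hxy

/-- The bracket of a word with `m + 2` letters that corresponds to a facet of the graph
cubeahedron of a path with `m` nodes. -/
def bracketOf : Facet (Fin m) → ℕ × ℕ
  -- Nodes count from 0, and node `v` stands for the gap between the letters `v + 2` and `v + 3`. A
  -- tube becomes the bracket that spans its gaps, a square tube the initial bracket that ends just
  -- before its gap; `(0, 0)` is a junk value.
  | .zero _ => (0, 0)
  | .one v => (1, v + 2)
  | .tube t => if h : t.Nonempty then (t.min' h + 2, t.max' h + 3) else (0, 0)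

theorem bracketOf_Icc {a b : Fin m} (hab : a ≤ b) :
    bracketOf (.tube (Finset.Icc a b)) = (a.val + 2, b.val + 3) := by
  have hne := Finset.nonempty_Icc.2 hab
  have h1 : (Finset.Icc a b).min' hne = a :=
    le_antisymm (Finset.min'_le _ _ (Finset.left_mem_Icc.2 hab))
      (Finset.mem_Icc.1 (Finset.min'_mem _ hne)).1
  have h2 : (Finset.Icc a b).max' hne = b :=
    le_antisymm (Finset.mem_Icc.1 (Finset.max'_mem _ hne)).2
      (Finset.le_max' _ _ (Finset.right_mem_Icc.2 hab))
  rw [bracketOf, dif_pos hne, h1, h2]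

/-- The labels of the facets of the graph cubeahedron of a path with `m` nodes. -/
def pathFacets (m : ℕ) : Finset (Facet (Fin m)) :=
  Finset.univ.image .one ∪
    ((Finset.univ ×ˢ Finset.univ).filter fun p : Fin m × Fin m => p.1 ≤ p.2).image
      fun p => .tube (Finset.Icc p.1 p.2)

theorem mem_pathFacets {f : Facet (Fin m)} :
    f ∈ pathFacets m ↔
      (∃ v, f = .one v) ∨ ∃ a b, a ≤ b ∧ f = .tube (Finset.Icc a b) := by
  simp [pathFacets, eq_comm]

/-- Adjacent intervals give brackets that share one letter, hence cross. An initial bracket ending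
at a gap crosses exactly the brackets that span this gap, and initial brackets are always nested. -/
theorem isDesignTubing_pathGraph_iff {S : Finset (Facet (Fin m))} :
    IsDesignTubing (SimpleGraph.pathGraph m) S ↔
      S ⊆ pathFacets m ∧ ∀ f ∈ S, ∀ g ∈ S, BracketsCompatible (bracketOf f) (bracketOf g) := by
  have key : ∀ {a b a' b' : Fin m}, a ≤ b → a' ≤ b' →
      ((Finset.Icc a b ⊆ Finset.Icc a' b' ∨ Finset.Icc a' b' ⊆ Finset.Icc a b ∨
        ¬IsRoundTube (SimpleGraph.pathGraph m) (Finset.Icc a b ∪ Finset.Icc a' b')) ↔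
      BracketsCompatible (a.val + 2, b.val + 3) (a'.val + 2, b'.val + 3)) := by
    intro a b a' b' hab hab'
    by_cases h : Finset.Icc a b ⊆ Finset.Icc a' b'
    · refine iff_of_true (Or.inl h) ?_
      rw [Finset.Icc_subset_Icc_iff hab, Fin.le_def, Fin.le_def] at h
      simp only [BracketsCompatible]
      omega
    · by_cases h' : Finset.Icc a' b' ⊆ Finset.Icc a b
      · refine iff_of_true (Or.inr (Or.inl h')) ?_
        rw [Finset.Icc_subset_Icc_iff hab', Fin.le_def, Fin.le_def] at h'
        simp only [BracketsCompatible]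
        omega
      · rw [isRoundTube_Icc_union_Icc hab hab' h h']
        simp only [h, h', false_or, BracketsCompatible]
        rw [Finset.Icc_subset_Icc_iff hab, Fin.le_def, Fin.le_def] at h
        rw [Finset.Icc_subset_Icc_iff hab', Fin.le_def, Fin.le_def] at h'
        omega
  have key' : ∀ {v a b : Fin m}, a ≤ b → (v ∉ Finset.Icc a b ↔
      BracketsCompatible (1, v.val + 2) (a.val + 2, b.val + 3)) := by
    intro v a b hab
    simp only [Finset.mem_Icc, Fin.le_def, BracketsCompatible] at *
    omega
  constructor
  · intro h
    have hS : S ⊆ pathFacets m := fun f hf => by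
      cases f with
      | zero v => exact absurd hf (h.zero_notMem v)
      | one v => exact mem_pathFacets.2 (Or.inl ⟨v, rfl⟩)
      | tube t =>
        obtain ⟨a, b, hab, rfl⟩ := (h.isRoundTube t hf).exists_eq_Icc
        exact mem_pathFacets.2 (Or.inr ⟨a, b, hab, rfl⟩)
    refine ⟨hS, fun f hf g hg => ?_⟩
    rcases mem_pathFacets.1 (hS hf) with ⟨v, rfl⟩ | ⟨a, b, hab, rfl⟩ <;>
      rcases mem_pathFacets.1 (hS hg) with ⟨w, rfl⟩ | ⟨a', b', hab', rfl⟩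
    · simp only [bracketOf, BracketsCompatible]
      omega
    · rw [bracketOf_Icc hab', bracketOf]
      exact (key' hab').1 (h.notMem _ _ hf hg)
    · have := (key' hab).1 (h.notMem _ _ hg hf)
      rw [bracketOf_Icc hab, bracketOf]
      simp only [BracketsCompatible] at *
      omega
    · rw [bracketOf_Icc hab, bracketOf_Icc hab']
      exact (key hab hab').1 (h.compatible _ _ hf hg)
  · rintro ⟨hS, hc⟩
    have htube : ∀ t, .tube t ∈ S → ∃ a b, a ≤ b ∧ t = Finset.Icc a b := fun t ht => by
      rcases mem_pathFacets.1 (hS ht) with ⟨v, hv⟩ | ⟨a, b, hab, he⟩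
      · cases hv
      · exact ⟨a, b, hab, Facet.tube.inj he⟩
    refine ⟨fun v hv => ?_, fun t ht => ?_, fun t t' ht ht' => ?_, fun v t hv ht => ?_⟩
    · rcases mem_pathFacets.1 (hS hv) with ⟨w, hw⟩ | ⟨a, b, -, he⟩
      · cases hw
      · cases he
    · obtain ⟨a, b, hab, rfl⟩ := htube t ht
      exact isRoundTube_Icc hab
    · obtain ⟨a, b, hab, rfl⟩ := htube t ht
      obtain ⟨a', b', hab', rfl⟩ := htube t' ht'
      have := hc _ ht _ ht'
      rw [bracketOf_Icc hab, bracketOf_Icc hab'] at this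
      exact (key hab hab').2 this
    · obtain ⟨a, b, hab, rfl⟩ := htube t ht
      have := hc _ hv _ ht
      rw [bracketOf_Icc hab, bracketOf] at this
      exact (key' hab).2 this

theorem bracketOf_injOn : Set.InjOn bracketOf (pathFacets m : Set (Facet (Fin m))) := by
  intro f hf g hg he
  rcases mem_pathFacets.1 hf with ⟨v, rfl⟩ | ⟨a, b, hab, rfl⟩ <;>
    rcases mem_pathFacets.1 hg with ⟨w, rfl⟩ | ⟨a', b', hab', rfl⟩
  · simp only [bracketOf, Prod.mk.injEq, true_and, Nat.add_right_cancel_iff] at he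
    rw [Fin.ext he]
  · rw [bracketOf_Icc hab', bracketOf, Prod.mk.injEq] at he
    omega
  · rw [bracketOf_Icc hab, bracketOf, Prod.mk.injEq] at he
    omega
  · rw [bracketOf_Icc hab, bracketOf_Icc hab', Prod.mk.injEq] at he
    rw [Fin.ext (Nat.add_right_cancel he.1), Fin.ext (Nat.add_right_cancel he.2)]

theorem exists_bracketOf_eq_iff {b : ℕ × ℕ} :
    (∃ f ∈ pathFacets m, bracketOf f = b) ↔
      1 ≤ b.1 ∧ b.1 < b.2 ∧ b.2 ≤ m + 2 ∧ b ≠ (1, m + 2) := by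
  obtain ⟨i, j⟩ := b
  constructor
  · rintro ⟨f, hf, he⟩
    rcases mem_pathFacets.1 hf with ⟨v, rfl⟩ | ⟨a, b, hab, rfl⟩
    · have := v.isLt
      simp only [bracketOf, Prod.mk.injEq, ne_eq] at *
      omega
    · have := b.isLt
      rw [Fin.le_def] at hab
      rw [bracketOf_Icc hab] at he
      simp only [Prod.mk.injEq, ne_eq] at *
      omega
  · rintro ⟨h1, h2, h3, h4⟩
    simp only [ne_eq, Prod.mk.injEq] at *
    by_cases hi : i = 1
    · refine ⟨.one ⟨j - 2, by omega⟩, mem_pathFacets.2 (Or.inl ⟨_, rfl⟩), ?_⟩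
      simp only [bracketOf, Prod.mk.injEq]
      omega
    · have hle : (⟨i - 2, by omega⟩ : Fin m) ≤ ⟨j - 3, by omega⟩ :=
        Fin.le_def.2 (by simp only; omega)
      refine ⟨_, mem_pathFacets.2 (Or.inr ⟨_, _, hle, rfl⟩), ?_⟩
      rw [bracketOf_Icc hle]
      simp only [Prod.mk.injEq]
      omega

theorem isBracketing_image_bracketOf {S : Finset (Facet (Fin m))}
    (hS : IsDesignTubing (SimpleGraph.pathGraph m) S) :
    IsBracketing (m + 2) (S.image bracketOf) := by
  rw [isDesignTubing_pathGraph_iff] at hS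
  refine ⟨fun b hb => ?_, fun b hb c hc => ?_⟩
  · obtain ⟨f, hf, rfl⟩ := Finset.mem_image.1 hb
    exact exists_bracketOf_eq_iff.1 ⟨f, hS.1 hf, rfl⟩
  · obtain ⟨f, hf, rfl⟩ := Finset.mem_image.1 hb
    obtain ⟨g, hg, rfl⟩ := Finset.mem_image.1 hc
    exact hS.2 f hf g hg

theorem image_bracketOf_subset_iff {S T : Finset (Facet (Fin m))} (hS : S ⊆ pathFacets m)
    (hT : T ⊆ pathFacets m) : S.image bracketOf ⊆ T.image bracketOf ↔ S ⊆ T := by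
  refine ⟨fun h f hf => ?_, fun h => Finset.image_subset_image h⟩
  obtain ⟨g, hg, he⟩ := Finset.mem_image.1 (h (Finset.mem_image_of_mem _ hf))
  exact bracketOf_injOn (hT hg) (hS hf) he ▸ hg

/-- The design tubings of a path with `m` nodes are the bracketings of `m + 2` letters. -/
noncomputable def pathTubingIso (m : ℕ) :
    ↥{S | IsDesignTubing (SimpleGraph.pathGraph m) S} ≃o ↥(bracketings (m + 2)) where
  toEquiv := Equiv.ofBijective
    (fun S => ⟨S.1.image bracketOf, isBracketing_image_bracketOf S.2⟩) (by
      constructor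
      · rintro ⟨S, hS⟩ ⟨T, hT⟩ he
        have he : S.image bracketOf = T.image bracketOf := congrArg Subtype.val he
        have hS := (isDesignTubing_pathGraph_iff.1 hS).1
        have hT := (isDesignTubing_pathGraph_iff.1 hT).1
        exact Subtype.ext (((image_bracketOf_subset_iff hS hT).1 he.subset).antisymm
          ((image_bracketOf_subset_iff hT hS).1 he.superset))
      · rintro ⟨B, hB⟩
        have himg : ((pathFacets m).filter fun f => bracketOf f ∈ B).image bracketOf = B := by
          ext b
          simp only [Finset.mem_image, Finset.mem_filter]
          constructor
          · rintro ⟨f, ⟨-, hf⟩, rfl⟩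
            exact hf
          · intro hb
            obtain ⟨f, hf, rfl⟩ := exists_bracketOf_eq_iff.2 (hB.1 b hb)
            exact ⟨f, ⟨hf, hb⟩, rfl⟩
        refine ⟨⟨(pathFacets m).filter fun f => bracketOf f ∈ B,
          isDesignTubing_pathGraph_iff.2 ⟨Finset.filter_subset _ _, fun f hf g hg => ?_⟩⟩,
          Subtype.ext himg⟩
        exact hB.2 _ (Finset.mem_filter.1 hf).2 _ (Finset.mem_filter.1 hg).2)
  map_rel_iff' := fun {S T} => image_bracketOf_subset_iff
    (isDesignTubing_pathGraph_iff.1 S.2).1 (isDesignTubing_pathGraph_iff.1 T.2).1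

/-- The faces of the graph cubeahedra of a path with `m` nodes are the bracketings of `m + 2`
letters. -/
theorem IsGraphCubeahedron.nonempty_bracketingPoset_orderIso {C : Set (Fin m → ℝ)}
    (h : IsGraphCubeahedron (SimpleGraph.pathGraph m) C) :
    Nonempty (BracketingPoset (m + 2) ≃o FacePoset C) := by
  obtain ⟨e⟩ := h.nonempty_orderIso
  exact ⟨(pathTubingIso m).symm.dual.trans e⟩

end PathGraph

/-! ### Juxtaposition of bracketed words -/

section Juxtapose

theorem mem_shiftBrackets {k : ℕ} {B : Finset (ℕ × ℕ)} {b : ℕ × ℕ} :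
    b ∈ shiftBrackets k B ↔ ∃ c ∈ B, (c.1 + k, c.2 + k) = b := by
  simp [shiftBrackets]

theorem shiftBrackets_zero (B : Finset (ℕ × ℕ)) : shiftBrackets 0 B = B := by
  simp [shiftBrackets]

theorem shiftBrackets_union (k : ℕ) (A B : Finset (ℕ × ℕ)) :
    shiftBrackets k (A ∪ B) = shiftBrackets k A ∪ shiftBrackets k B :=
  Finset.image_union _ _

theorem shiftBrackets_insert (k : ℕ) (b : ℕ × ℕ) (B : Finset (ℕ × ℕ)) :
    shiftBrackets k (insert b B) = insert (b.1 + k, b.2 + k) (shiftBrackets k B) :=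
  Finset.image_insert _ _ _

theorem shiftBrackets_shiftBrackets (k l : ℕ) (B : Finset (ℕ × ℕ)) :
    shiftBrackets k (shiftBrackets l B) = shiftBrackets (l + k) B := by
  rw [shiftBrackets, shiftBrackets, shiftBrackets, Finset.image_image]
  refine Finset.image_congr fun c _ => ?_
  simp [add_assoc]

theorem shiftBrackets_mono {k : ℕ} {A B : Finset (ℕ × ℕ)} (h : A ⊆ B) :
    shiftBrackets k A ⊆ shiftBrackets k B :=
  Finset.image_subset_image h

theorem mem_enclose {X : AssocRule} {b : ℕ × ℕ} :
    b ∈ enclose X ↔ (2 ≤ X.1 ∧ b = (1, X.1)) ∨ b ∈ X.2 := by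
  unfold enclose
  split_ifs with h <;> simp [h]

theorem enclose_insert (k : ℕ) (b : ℕ × ℕ) (B : Finset (ℕ × ℕ)) :
    enclose (k, insert b B) = insert b (enclose (k, B)) := by
  unfold enclose
  split_ifs with h
  · simp only
    rw [Finset.insert_comm]
  · rfl

theorem subset_enclose (X : AssocRule) : X.2 ⊆ enclose X := fun _ hb => mem_enclose.2 (Or.inr hb)

theorem enclose_of_two_le {X : AssocRule} (h : 2 ≤ X.1) : enclose X = insert (1, X.1) X.2 :=
  if_pos h

theorem juxtapose_cons_fst (X : AssocRule) (Xs : List AssocRule) :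
    (juxtapose (X :: Xs)).1 = X.1 + (juxtapose Xs).1 := rfl

theorem juxtapose_cons_snd (X : AssocRule) (Xs : List AssocRule) :
    (juxtapose (X :: Xs)).2 = enclose X ∪ shiftBrackets X.1 (juxtapose Xs).2 := rfl

theorem juxtapose_fst (Xs : List AssocRule) : (juxtapose Xs).1 = (Xs.map Prod.fst).sum := by
  induction Xs with
  | nil => rfl
  | cons X Xs ih => rw [juxtapose_cons_fst, ih, List.map_cons, List.sum_cons]

theorem juxtapose_append_fst (Xs Ys : List AssocRule) :
    (juxtapose (Xs ++ Ys)).1 = (juxtapose Xs).1 + (juxtapose Ys).1 := by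
  simp [juxtapose_fst]

theorem juxtapose_append_snd (Xs Ys : List AssocRule) :
    (juxtapose (Xs ++ Ys)).2 =
      (juxtapose Xs).2 ∪ shiftBrackets (juxtapose Xs).1 (juxtapose Ys).2 := by
  induction Xs with
  | nil => simp [juxtapose, shiftBrackets_zero]
  | cons X Xs ih =>
    rw [List.cons_append, juxtapose_cons_snd, ih, juxtapose_cons_snd, juxtapose_cons_fst,
      shiftBrackets_union, shiftBrackets_shiftBrackets, Finset.union_assoc, add_comm X.1]

/-- A bracketing of at least one letter. -/
def IsRule (X : AssocRule) : Prop :=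
  1 ≤ X.1 ∧ IsBracketing X.1 X.2

/-- Brackets of a word with `n` letters that are pairwise nested or disjoint; the bracket around
the whole word is allowed. -/
def IsLaminar (n : ℕ) (B : Finset (ℕ × ℕ)) : Prop :=
  (∀ b ∈ B, 1 ≤ b.1 ∧ b.1 < b.2 ∧ b.2 ≤ n) ∧ ∀ b ∈ B, ∀ c ∈ B, BracketsCompatible b c

theorem IsLaminar.isBracketing {n : ℕ} {B : Finset (ℕ × ℕ)} (h : IsLaminar n B)
    (hn : (1, n) ∉ B) : IsBracketing n B :=
  ⟨fun b hb => ⟨(h.1 b hb).1, (h.1 b hb).2.1, (h.1 b hb).2.2, fun he => hn (he ▸ hb)⟩, h.2⟩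

theorem IsRule.isLaminar_enclose {X : AssocRule} (h : IsRule X) : IsLaminar X.1 (enclose X) := by
  refine ⟨fun b hb => ?_, fun b hb c hc => ?_⟩
  · rcases mem_enclose.1 hb with ⟨h2, rfl⟩ | hb
    · exact ⟨le_rfl, h2, le_rfl⟩
    · have := h.2.1 b hb
      exact ⟨this.1, this.2.1, this.2.2.1⟩
  · rcases mem_enclose.1 hb with ⟨-, rfl⟩ | hb <;> rcases mem_enclose.1 hc with ⟨-, rfl⟩ | hc
    · exact Or.inl ⟨le_rfl, le_rfl⟩
    · have := h.2.1 c hc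
      exact Or.inl ⟨this.1, this.2.2.1⟩
    · have := h.2.1 b hb
      exact Or.inr (Or.inl ⟨this.1, this.2.2.1⟩)
    · exact h.2.2 b hb c hc

theorem isLaminar_juxtapose {Xs : List AssocRule} (h : ∀ X ∈ Xs, IsRule X) :
    IsLaminar (juxtapose Xs).1 (juxtapose Xs).2 := by
  induction Xs with
  | nil => simp [juxtapose, IsLaminar]
  | cons X Xs ih =>
    have h1 := (h X List.mem_cons_self).isLaminar_enclose
    have h2 := ih fun Y hY => h Y (List.mem_cons_of_mem _ hY)
    rw [juxtapose_cons_fst, juxtapose_cons_snd]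
    refine ⟨fun b hb => ?_, fun b hb c hc => ?_⟩
    · rcases Finset.mem_union.1 hb with hb | hb
      · have := h1.1 b hb
        omega
      · obtain ⟨b, hb', rfl⟩ := mem_shiftBrackets.1 hb
        have := h2.1 b hb'
        simp only
        omega
    · rcases Finset.mem_union.1 hb with hb | hb <;> rcases Finset.mem_union.1 hc with hc | hc
      · exact h1.2 b hb c hc
      · obtain ⟨c, hc', rfl⟩ := mem_shiftBrackets.1 hc
        have := h1.1 b hb
        have := h2.1 c hc'
        simp only [BracketsCompatible]
        omega
      · obtain ⟨b, hb', rfl⟩ := mem_shiftBrackets.1 hb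
        have := h1.1 c hc
        have := h2.1 b hb'
        simp only [BracketsCompatible]
        omega
      · obtain ⟨b, hb', rfl⟩ := mem_shiftBrackets.1 hb
        obtain ⟨c, hc', rfl⟩ := mem_shiftBrackets.1 hc
        have := h2.2 b hb' c hc'
        simp only [BracketsCompatible] at *
        omega

/-- Every bracket lies within the head or within the tail. As both are nonempty, none encloses the
whole word. -/
theorem isRule_juxtapose_cons {X : AssocRule} {Xs : List AssocRule} (hX : IsRule X)
    (h : ∀ X ∈ Xs, IsRule X) (hne : Xs ≠ []) : IsRule (juxtapose (X :: Xs)) := by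
  have hlam := isLaminar_juxtapose (List.forall_mem_cons.2 ⟨hX, h⟩)
  have hX1 := hX.1
  have hpos : 1 ≤ (juxtapose Xs).1 := by
    obtain ⟨Y, Ys, rfl⟩ := List.exists_cons_of_ne_nil hne
    have := (h Y List.mem_cons_self).1
    rw [juxtapose_cons_fst]
    omega
  refine ⟨by rw [juxtapose_cons_fst]; omega, hlam.isBracketing fun hmem => ?_⟩
  rw [juxtapose_cons_fst, juxtapose_cons_snd, Finset.mem_union] at hmem
  rcases hmem with hmem | hmem
  · have := hX.isLaminar_enclose.1 _ hmem
    simp only at this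
    omega
  · obtain ⟨c, hc, he⟩ := mem_shiftBrackets.1 hmem
    have := (isLaminar_juxtapose h).1 c hc
    simp only [Prod.mk.injEq] at he
    omega

/-- No bracket straddles the end of the head, so head and tail can be read off by position once the
length of the head is known. -/
theorem mem_enclose_iff_mem_juxtapose {X : AssocRule} {Xs : List AssocRule} (hX : IsRule X)
    (h : ∀ X ∈ Xs, IsRule X) {b : ℕ × ℕ} :
    b ∈ enclose X ↔ b ∈ (juxtapose (X :: Xs)).2 ∧ b.2 ≤ X.1 := by
  rw [juxtapose_cons_snd, Finset.mem_union]
  constructor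
  · exact fun hb => ⟨Or.inl hb, (hX.isLaminar_enclose.1 b hb).2.2⟩
  · rintro ⟨hb | hb, hle⟩
    · exact hb
    · obtain ⟨c, hc, rfl⟩ := mem_shiftBrackets.1 hb
      have := (isLaminar_juxtapose h).1 c hc
      simp only at hle
      omega

theorem mem_juxtapose_tail_iff {X : AssocRule} {Xs : List AssocRule} (hX : IsRule X)
    (h : ∀ X ∈ Xs, IsRule X) {b : ℕ × ℕ} :
    b ∈ (juxtapose Xs).2 ↔
      1 ≤ b.1 ∧ 1 ≤ b.2 ∧ (b.1 + X.1, b.2 + X.1) ∈ (juxtapose (X :: Xs)).2 := by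
  rw [juxtapose_cons_snd, Finset.mem_union]
  constructor
  · intro hb
    have := (isLaminar_juxtapose h).1 b hb
    exact ⟨this.1, by omega, Or.inr (mem_shiftBrackets.2 ⟨b, hb, rfl⟩)⟩
  · rintro ⟨h1, h2, hb | hb⟩
    · have := hX.isLaminar_enclose.1 _ hb
      simp only at this
      omega
    · obtain ⟨c, hc, he⟩ := mem_shiftBrackets.1 hb
      simp only [Prod.mk.injEq, Nat.add_right_cancel_iff] at he
      rwa [← Prod.ext he.1 he.2]

/-- If `X` has two or more letters, its own bracket starts at letter 1 and therefore lies within the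
first factor on the other side; a single letter always fits. -/
theorem head_le_of_juxtapose_subset {X Y : AssocRule} {Xs Ys : List AssocRule} (hX : IsRule X)
    (hY : IsRule Y) (hYs : ∀ X ∈ Ys, IsRule X)
    (h : (juxtapose (X :: Xs)).2 ⊆ (juxtapose (Y :: Ys)).2) : X.1 ≤ Y.1 := by
  have hX1 := hX.1
  have hY1 := hY.1
  by_cases h2 : 2 ≤ X.1
  · have hmem : (1, X.1) ∈ (juxtapose (Y :: Ys)).2 :=
      h (Finset.mem_union_left _ (mem_enclose.2 (Or.inl ⟨h2, rfl⟩)))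
    rw [juxtapose_cons_snd, Finset.mem_union] at hmem
    rcases hmem with hmem | hmem
    · exact (hY.isLaminar_enclose.1 _ hmem).2.2
    · obtain ⟨c, hc, he⟩ := mem_shiftBrackets.1 hmem
      have := (isLaminar_juxtapose hYs).1 c hc
      simp only [Prod.mk.injEq] at he
      omega
  · omega

theorem IsRule.eq_of_enclose_eq {X Y : AssocRule} (hX : IsRule X) (hY : IsRule Y)
    (h1 : X.1 = Y.1) (h : enclose X = enclose Y) : X = Y := by
  have key : ∀ Z : AssocRule, IsRule Z → Z.2 = (enclose Z).erase (1, Z.1) := by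
    intro Z hZ
    ext b
    rw [Finset.mem_erase, mem_enclose]
    constructor
    · exact fun hb => ⟨(hZ.2.1 b hb).2.2.2, Or.inr hb⟩
    · rintro ⟨hne, ⟨-, he⟩ | hb⟩
      · exact absurd he hne
      · exact hb
  refine Prod.ext h1 ?_
  rw [key X hX, key Y hY, h, h1]

/-- The two head lengths bound each other; after that the head and the tail are determined by
position. -/
theorem juxtapose_inj {Xs Ys : List AssocRule} (hXs : ∀ X ∈ Xs, IsRule X)
    (hYs : ∀ X ∈ Ys, IsRule X) (h : juxtapose Xs = juxtapose Ys) : Xs = Ys := by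
  induction Xs generalizing Ys with
  | nil =>
    cases Ys with
    | nil => rfl
    | cons Y Ys =>
      have := (hYs Y List.mem_cons_self).1
      have h1 := congrArg Prod.fst h
      rw [juxtapose_cons_fst] at h1
      simp only [juxtapose] at h1
      omega
  | cons X Xs ih =>
    cases Ys with
    | nil =>
      have := (hXs X List.mem_cons_self).1
      have h1 := congrArg Prod.fst h
      rw [juxtapose_cons_fst] at h1
      simp only [juxtapose] at h1
      omega
    | cons Y Ys =>
      rw [List.forall_mem_cons] at hXs hYs
      have h2 := congrArg Prod.snd h
      have hfst : X.1 = Y.1 :=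
        (head_le_of_juxtapose_subset hXs.1 hYs.1 hYs.2 h2.subset).antisymm
          (head_le_of_juxtapose_subset hYs.1 hXs.1 hXs.2 h2.superset)
      have hhead : X = Y := by
        refine hXs.1.eq_of_enclose_eq hYs.1 hfst (Finset.ext fun b => ?_)
        rw [mem_enclose_iff_mem_juxtapose hXs.1 hXs.2,
          mem_enclose_iff_mem_juxtapose hYs.1 hYs.2, h, hfst]
      subst hhead
      congr 1
      refine ih hXs.2 hYs.2 (Prod.ext ?_ (Finset.ext fun b => ?_))
      · have h1 := congrArg Prod.fst h
        rw [juxtapose_cons_fst, juxtapose_cons_fst] at h1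
        exact Nat.add_left_cancel h1
      · rw [mem_juxtapose_tail_iff hXs.1 hXs.2, mem_juxtapose_tail_iff hXs.1 hYs.2, h]

/-- A factor with two or more letters is enclosed by a bracket, so a cut after letter `p` that
crosses no bracket falls between factors. -/
theorem exists_split_of_boundary {Xs : List AssocRule} {p : ℕ}
    (hp : p ≤ (juxtapose Xs).1) (hb : ∀ c ∈ (juxtapose Xs).2, ¬(c.1 ≤ p ∧ p < c.2)) :
    ∃ As Bs, Xs = As ++ Bs ∧ (juxtapose As).1 = p := by
  induction Xs generalizing p with
  | nil => exact ⟨[], [], rfl, by simpa [juxtapose, eq_comm] using hp⟩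
  | cons X Xs ih =>
    rcases Nat.eq_zero_or_pos p with rfl | hpos
    · exact ⟨[], X :: Xs, rfl, rfl⟩
    · have hle : X.1 ≤ p := by
        by_contra hlt
        exact hb (1, X.1) (Finset.mem_union_left _ (mem_enclose.2 (Or.inl ⟨by omega, rfl⟩)))
          ⟨hpos, by simp only; omega⟩
      obtain ⟨As, Bs, rfl, hAs⟩ := ih (p := p - X.1)
        (by rw [juxtapose_cons_fst] at hp; omega) (fun c hc hcon =>
          hb (c.1 + X.1, c.2 + X.1)
            (Finset.mem_union_right _ (mem_shiftBrackets.2 ⟨c, hc, rfl⟩))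
            ⟨by simp only; omega, by simp only; omega⟩)
      exact ⟨X :: As, Bs, rfl, by rw [juxtapose_cons_fst, hAs]; omega⟩

theorem exists_factor_of_mem_juxtapose {Xs : List AssocRule} (h : ∀ X ∈ Xs, IsRule X)
    {c : ℕ × ℕ} (hc : c ∈ (juxtapose Xs).2) :
    ∃ As X Bs, Xs = As ++ X :: Bs ∧ (juxtapose As).1 < c.1 ∧ c.2 ≤ (juxtapose As).1 + X.1 := by
  induction Xs generalizing c with
  | nil => simp [juxtapose] at hc
  | cons X Xs ih =>
    rw [List.forall_mem_cons] at h
    rw [juxtapose_cons_snd, Finset.mem_union] at hc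
    rcases hc with hc | hc
    · have := h.1.isLaminar_enclose.1 c hc
      refine ⟨[], X, Xs, rfl, ?_, ?_⟩ <;> simp only [juxtapose] <;> omega
    · obtain ⟨c, hc', rfl⟩ := mem_shiftBrackets.1 hc
      obtain ⟨As, Y, Bs, rfl, h1, h2⟩ := ih h.2 hc'
      refine ⟨X :: As, Y, Bs, rfl, ?_, ?_⟩ <;> rw [juxtapose_cons_fst] <;> simp only <;> omega

/-- A bracket that can be added to `X₁ · X₂ ⋯ Xₘ` is added by one operation. -/
theorem exists_operation_insert {E : List AssocRule} (hE : ∀ X ∈ E, IsRule X) {b : ℕ × ℕ}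
    (hb1 : 1 ≤ b.1) (hb2 : b.1 < b.2) (hb3 : b.2 ≤ (juxtapose E).1) (hb : b ∉ (juxtapose E).2)
    (hcomp : ∀ c ∈ (juxtapose E).2, BracketsCompatible b c) :
    ∃ E' : List AssocRule, E' ≠ [] ∧ (∀ X ∈ E', IsRule X) ∧
      juxtapose E' = ((juxtapose E).1, insert b (juxtapose E).2) ∧
      ∀ Es Fs, Operation (Es ++ E' :: Fs) (Es ++ E :: Fs) := by
  obtain ⟨i, j⟩ := b
  simp only at hb1 hb2 hb3
  -- A bracket inside an existing one lies within a single factor and is added there. Otherwise no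
  -- bracket crosses either of its ends, and it encloses a run of whole factors whose dots are
  -- removed.
  by_cases hin : ∃ c ∈ (juxtapose E).2, c.1 ≤ i ∧ j ≤ c.2
  · obtain ⟨c, hc, hci, hcj⟩ := hin
    obtain ⟨As, ⟨k, B⟩, Bs, rfl, h1, h2⟩ := exists_factor_of_mem_juxtapose hE hc
    simp only at h2
    set o := (juxtapose As).1 with ho
    have hX : IsRule (k, B) := hE _ (by simp)
    have hmem : ∀ d ∈ enclose (k, B), (d.1 + o, d.2 + o) ∈ (juxtapose (As ++ (k, B) :: Bs)).2 :=
      fun d hd => by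
        rw [juxtapose_append_snd, juxtapose_cons_snd, shiftBrackets_union]
        exact Finset.mem_union_right _ (Finset.mem_union_left _ (mem_shiftBrackets.2 ⟨d, hd, rfl⟩))
    have hrule : IsRule (k, insert (i - o, j - o) B) := by
      refine ⟨hX.1, IsLaminar.isBracketing ⟨fun d hd => ?_, fun d hd e he => ?_⟩ fun hd => ?_⟩
      · rcases Finset.mem_insert.1 hd with rfl | hd
        · simp only
          omega
        · have := hX.2.1 d hd
          exact ⟨this.1, this.2.1, this.2.2.1⟩
      · rcases Finset.mem_insert.1 hd with rfl | hd <;> rcases Finset.mem_insert.1 he with rfl | he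
        · exact Or.inl ⟨le_rfl, le_rfl⟩
        · have := hcomp _ (hmem e (subset_enclose _ he))
          simp only [BracketsCompatible] at *
          omega
        · have := hcomp _ (hmem d (subset_enclose _ hd))
          simp only [BracketsCompatible] at *
          omega
        · exact hX.2.2 d hd e he
      · simp only at hd
        rcases Finset.mem_insert.1 hd with he | hd
        · rw [Prod.mk.injEq] at he
          refine hb ?_
          convert hmem (1, k) (mem_enclose.2 (Or.inl ⟨by simp only; omega, rfl⟩)) using 2 <;>
            simp only <;> omega
        · exact (hX.2.1 _ hd).2.2.2 rfl
    refine ⟨As ++ (k, insert (i - o, j - o) B) :: Bs, by simp, ?_, Prod.ext ?_ ?_, fun Es Fs => ?_⟩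
    · intro Y hY
      rcases List.mem_append.1 hY with hY | hY
      · exact hE Y (List.mem_append_left _ hY)
      · rcases List.mem_cons.1 hY with rfl | hY
        · exact hrule
        · exact hE Y (List.mem_append_right _ (List.mem_cons_of_mem _ hY))
    · simp only [juxtapose_append_fst, juxtapose_cons_fst]
    · simp only [juxtapose_append_snd, juxtapose_cons_snd, enclose_insert, Finset.insert_union,
        shiftBrackets_insert, Finset.union_insert, ← ho]
      congr 2 <;> omega
    · exact .addBrackets Es Fs As Bs k _ _ (Finset.subset_insert _ _)
  · have hbd : ∀ c ∈ (juxtapose E).2, ¬(c.1 ≤ i - 1 ∧ i - 1 < c.2) ∧ ¬(c.1 ≤ j ∧ j < c.2) := by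
      intro c hc
      have h1 := hcomp c hc
      have h2 : ¬(c.1 ≤ i ∧ j ≤ c.2) := fun h => hin ⟨c, hc, h⟩
      simp only [BracketsCompatible] at h1
      omega
    obtain ⟨As, Ys, rfl, hAs⟩ := exists_split_of_boundary hb3 fun c hc => (hbd c hc).2
    obtain ⟨Xs, Zs, rfl, hXs⟩ := exists_split_of_boundary (Xs := As) (p := i - 1) (by omega)
      fun c hc => (hbd c (by
        rw [juxtapose_append_snd]
        exact Finset.mem_union_left _ hc)).1
    rw [juxtapose_append_fst, hXs] at hAs
    have hZmem : ∀ d ∈ (juxtapose Zs).2,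
        (d.1 + (i - 1), d.2 + (i - 1)) ∈ (juxtapose (Xs ++ Zs ++ Ys)).2 := fun d hd => by
      rw [juxtapose_append_snd, juxtapose_append_snd, hXs]
      exact Finset.mem_union_left _ (Finset.mem_union_right _ (mem_shiftBrackets.2 ⟨d, hd, rfl⟩))
    have hbZ : (1, (juxtapose Zs).1) ∉ (juxtapose Zs).2 := fun hmem => hb <| by
      convert hZmem _ hmem using 2 <;> simp only <;> omega
    -- A run consisting of one factor would already carry the bracket.
    have hZ : 2 ≤ Zs.length := by
      match Zs, hAs, hbZ with
      | [], hAs, _ =>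
        simp only [juxtapose] at hAs
        omega
      | [X], hAs, hbZ =>
        rw [juxtapose_cons_fst, juxtapose] at hAs
        refine absurd (Finset.mem_union_left _ (mem_enclose.2 (Or.inl ⟨?_, rfl⟩))) hbZ
        simp only at hAs
        omega
      | _ :: _ :: _, _, _ => simp
    have hZrule : IsRule (juxtapose Zs) :=
      ⟨by omega, (isLaminar_juxtapose fun X hX => hE X (by simp [hX])).isBracketing hbZ⟩
    refine ⟨Xs ++ juxtapose Zs :: Ys, by simp, ?_, Prod.ext ?_ ?_, fun Es Fs => ?_⟩
    · intro Y hY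
      rcases List.mem_append.1 hY with hY | hY
      · exact hE Y (by simp [hY])
      · rcases List.mem_cons.1 hY with rfl | hY
        · exact hZrule
        · exact hE Y (by simp [hY])
    · simp only [juxtapose_append_fst, juxtapose_cons_fst, add_assoc]
    · rw [juxtapose_append_snd, juxtapose_cons_snd, enclose_of_two_le (by omega),
        juxtapose_append_snd, juxtapose_append_snd, Finset.insert_union, shiftBrackets_insert,
        Finset.union_insert, shiftBrackets_union, shiftBrackets_shiftBrackets,
        hXs, Finset.union_assoc]
      have he : (1 + (i - 1), (juxtapose Zs).1 + (i - 1)) = (i, j) :=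
        Prod.ext (by simp only; omega) (by simp only; omega)
      simp only
      rw [he, juxtapose_append_fst, hXs, add_comm (i - 1)]
    · exact .removeDots Es Fs Xs Zs Ys hZ

end Juxtapose

/-! ### Collapsed multiplihedra as bracketings with an extra first letter -/

section Multiplihedra

/-- All the factors of the list are products of one or more rules of association. -/
def IsValid (Es : List (List AssocRule)) : Prop :=
  ∀ E ∈ Es, E ≠ [] ∧ ∀ X ∈ E, IsRule X

theorem isValid_concat {Es : List (List AssocRule)} {E : List AssocRule} :
    IsValid (Es ++ [E]) ↔ IsValid Es ∧ E ≠ [] ∧ ∀ X ∈ E, IsRule X := by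
  simp [IsValid, or_imp, forall_and]
  tauto

/-- The bracketing of the word `(⋯((x E₁) E₂) ⋯) Eₖ`, where `x` is an additional first letter. -/
def leftNest (Es : List (List AssocRule)) : AssocRule :=
  Es.foldl (fun X E => juxtapose (X :: E)) (1, ∅)

theorem leftNest_concat (Es : List (List AssocRule)) (E : List AssocRule) :
    leftNest (Es ++ [E]) = juxtapose (leftNest Es :: E) := by
  simp [leftNest]

theorem leftNest_fst (Es : List (List AssocRule)) :
    (leftNest Es).1 = (Es.map fun E => (E.map Prod.fst).sum).sum + 1 := by
  induction Es using List.reverseRecOn with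
  | nil => rfl
  | append_singleton Es E ih =>
    rw [leftNest_concat, juxtapose_cons_fst, ih, juxtapose_fst]
    simp only [List.map_append, List.map_cons, List.map_nil, List.sum_append, List.sum_cons,
      List.sum_nil]
    omega

theorem isRule_leftNest {Es : List (List AssocRule)} (h : IsValid Es) : IsRule (leftNest Es) := by
  induction Es using List.reverseRecOn with
  | nil => simp [leftNest, IsRule, IsBracketing]
  | append_singleton Es E ih =>
    rw [isValid_concat] at h
    rw [leftNest_concat]
    exact isRule_juxtapose_cons (ih h.1) h.2.2 h.2.1

theorem one_lt_leftNest_concat {Es : List (List AssocRule)} {E : List AssocRule}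
    (h : IsValid (Es ++ [E])) : 1 < (leftNest (Es ++ [E])).1 := by
  rw [isValid_concat] at h
  obtain ⟨X, Xs, rfl⟩ := List.exists_cons_of_ne_nil h.2.1
  have h1 := (isRule_leftNest h.1).1
  have h2 := (h.2.2 X List.mem_cons_self).1
  rw [leftNest_concat, juxtapose_cons_fst, juxtapose_cons_fst]
  omega

/-- Injectivity of the outermost juxtaposition recovers the last factor and the nest of the earlier
ones, so factors peel off from the right. -/
theorem leftNest_inj {Es Fs : List (List AssocRule)} (hE : IsValid Es) (hF : IsValid Fs)
    (h : leftNest Es = leftNest Fs) : Es = Fs := by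
  induction Es using List.reverseRecOn generalizing Fs with
  | nil =>
    rcases List.eq_nil_or_concat Fs with rfl | ⟨Fs, F, rfl⟩
    · rfl
    · rw [List.concat_eq_append] at hF h
      have := one_lt_leftNest_concat hF
      rw [← h] at this
      simp [leftNest] at this
  | append_singleton Es E ih =>
    rcases List.eq_nil_or_concat Fs with rfl | ⟨Fs, F, rfl⟩
    · have := one_lt_leftNest_concat hE
      rw [h] at this
      simp [leftNest] at this
    · rw [List.concat_eq_append] at hF h ⊢
      rw [leftNest_concat, leftNest_concat] at h
      rw [isValid_concat] at hE hF
      have := juxtapose_inj (List.forall_mem_cons.2 ⟨isRule_leftNest hE.1, hE.2.2⟩)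
        (List.forall_mem_cons.2 ⟨isRule_leftNest hF.1, hF.2.2⟩) h
      rw [List.cons.injEq] at this
      rw [ih hE.1 hF.1 this.1, this.2]

/-- `Y` is obtained from `X` by adding brackets. -/
def Refines (X Y : AssocRule) : Prop :=
  X.1 = Y.1 ∧ X.2 ⊆ Y.2

theorem Refines.refl (X : AssocRule) : Refines X X := ⟨rfl, subset_rfl⟩

theorem Refines.enclose_subset {X Y : AssocRule} (h : Refines X Y) : enclose X ⊆ enclose Y := by
  intro b hb
  rw [mem_enclose] at *
  rw [← h.1]
  exact hb.imp_right fun hb => h.2 hb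

theorem Refines.cons {X Y : AssocRule} {Xs Ys : List AssocRule} (h : Refines X Y)
    (hs : Refines (juxtapose Xs) (juxtapose Ys)) :
    Refines (juxtapose (X :: Xs)) (juxtapose (Y :: Ys)) := by
  refine ⟨by rw [juxtapose_cons_fst, juxtapose_cons_fst, h.1, hs.1], ?_⟩
  rw [juxtapose_cons_snd, juxtapose_cons_snd, h.1]
  exact Finset.union_subset_union h.enclose_subset (shiftBrackets_mono hs.2)

theorem Refines.append {As Bs Cs Ds : List AssocRule} (h : Refines (juxtapose As) (juxtapose Bs))
    (h' : Refines (juxtapose Cs) (juxtapose Ds)) :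
    Refines (juxtapose (As ++ Cs)) (juxtapose (Bs ++ Ds)) := by
  refine ⟨by rw [juxtapose_append_fst, juxtapose_append_fst, h.1, h'.1], ?_⟩
  rw [juxtapose_append_snd, juxtapose_append_snd, h.1]
  exact Finset.union_subset_union h.2 (shiftBrackets_mono h'.2)

/-- Enclosing an initial run of factors only adds a bracket. This covers both `splitDot`, where the
run begins with the nest of the earlier factors, and `removeDots`. -/
theorem refines_append_juxtapose_cons (As Bs : List AssocRule) :
    Refines (juxtapose (As ++ Bs)) (juxtapose (juxtapose As :: Bs)) := by
  refine ⟨by rw [juxtapose_append_fst, juxtapose_cons_fst], ?_⟩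
  rw [juxtapose_append_snd, juxtapose_cons_snd]
  exact Finset.union_subset_union (subset_enclose _) subset_rfl

theorem Refines.foldl {X Y : AssocRule} (h : Refines X Y) (Fs : List (List AssocRule)) :
    Refines (Fs.foldl (fun X E => juxtapose (X :: E)) X)
      (Fs.foldl (fun X E => juxtapose (X :: E)) Y) := by
  induction Fs generalizing X Y with
  | nil => exact h
  | cons F Fs ih => exact ih (h.cons (.refl _))

theorem Operation.refines {P P' : List (List AssocRule)} (h : Operation P P') :
    Refines (leftNest P') (leftNest P) := by
  cases h with
  | addBrackets Es Fs Xs Ys k B B' h =>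
    rw [leftNest, leftNest, List.foldl_append, List.foldl_append, List.foldl_cons, List.foldl_cons]
    exact ((Refines.refl _).cons ((Refines.refl _).append
      (Refines.cons (X := (k, B')) (Y := (k, B)) ⟨rfl, h⟩ (.refl _)))).foldl Fs
  | splitDot Es Fs Xs Ys hX hY =>
    rw [leftNest, leftNest, List.foldl_append, List.foldl_append, List.foldl_cons, List.foldl_cons,
      List.foldl_cons]
    exact (refines_append_juxtapose_cons (_ :: Xs) Ys).foldl Fs
  | removeDots Es Fs Xs Zs Ys hZ =>
    rw [leftNest, leftNest, List.foldl_append, List.foldl_append, List.foldl_cons, List.foldl_cons,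
      List.append_assoc]
    exact ((Refines.refl _).cons ((Refines.refl _).append
      (refines_append_juxtapose_cons Zs Ys))).foldl Fs

theorem Operation.concat {P P' : List (List AssocRule)} (h : Operation P P')
    (E : List AssocRule) : Operation (P ++ [E]) (P' ++ [E]) := by
  cases h with
  | addBrackets Es Fs Xs Ys k B B' h =>
    simpa using Operation.addBrackets Es (Fs ++ [E]) Xs Ys k B B' h
  | splitDot Es Fs Xs Ys hX hY =>
    simpa using Operation.splitDot Es (Fs ++ [E]) Xs Ys hX hY
  | removeDots Es Fs Xs Zs Ys hZ =>
    simpa using Operation.removeDots Es (Fs ++ [E]) Xs Zs Ys hZ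

/-- A bracket that can be added to the bracketing of a product of factors is added by one
operation. -/
theorem exists_operation_leftNest_insert {Es : List (List AssocRule)} (h : IsValid Es)
    {b : ℕ × ℕ} (hb1 : 1 ≤ b.1) (hb2 : b.1 < b.2) (hb3 : b.2 ≤ (leftNest Es).1)
    (hne : b ≠ (1, (leftNest Es).1)) (hb : b ∉ (leftNest Es).2)
    (hcomp : ∀ c ∈ (leftNest Es).2, BracketsCompatible b c) :
    ∃ Es', IsValid Es' ∧ Operation Es' Es ∧
      leftNest Es' = ((leftNest Es).1, insert b (leftNest Es).2) := by
  induction Es using List.reverseRecOn with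
  | nil =>
    have : (leftNest []).1 = 1 := rfl
    omega
  | append_singleton Es E ih =>
    rw [isValid_concat] at h
    obtain ⟨hEs, hE0, hE⟩ := h
    have hX := isRule_leftNest hEs
    have hX1 := hX.1
    rw [leftNest_concat] at hb3 hne hb hcomp ⊢
    rw [juxtapose_cons_fst] at hb3 hne
    rw [juxtapose_cons_snd] at hb hcomp
    simp only [Finset.mem_union, not_or] at hb hcomp
    have hcompE : ∀ c ∈ (juxtapose E).2,
        BracketsCompatible b (c.1 + (leftNest Es).1, c.2 + (leftNest Es).1) :=
      fun c hc => hcomp _ (Or.inr (mem_shiftBrackets.2 ⟨c, hc, rfl⟩))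
    have hlamE := isLaminar_juxtapose hE
    -- There are three positions: within the nest of the earlier factors (induction), starting there
    -- and ending in the last factor (the dot at its end becomes `)f(`), or within the last factor.
    by_cases hj : b.2 ≤ (leftNest Es).1
    · have hne' : b ≠ (1, (leftNest Es).1) := fun he =>
        hb.1 (mem_enclose.2 (Or.inl ⟨by omega, he⟩))
      obtain ⟨Es', hv, hop, he⟩ := ih hEs hj hne' (fun h => hb.1 (subset_enclose _ h))
        fun c hc => hcomp c (Or.inl (subset_enclose _ hc))
      refine ⟨Es' ++ [E], isValid_concat.2 ⟨hv, hE0, hE⟩, hop.concat E, ?_⟩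
      rw [leftNest_concat, he]
      refine Prod.ext rfl ?_
      simp only [juxtapose_cons_snd, enclose_insert, Finset.insert_union, Prod.mk.eta]
    · by_cases hi : b.1 ≤ (leftNest Es).1
      · have hi1 : b.1 = 1 := by
          -- A later start would make `b` cross the bracket around the earlier nest.
          by_contra hi1
          have := hcomp _ (Or.inl (mem_enclose.2 (Or.inl ⟨by omega, rfl⟩)))
          simp only [BracketsCompatible] at this
          omega
        obtain ⟨Xs, Ys, rfl, hXs⟩ := exists_split_of_boundary (Xs := E)
          (p := b.2 - (leftNest Es).1) (by omega) fun c hc hcon => by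
            have h1 := hcompE c hc
            have h2 := hlamE.1 c hc
            simp only [BracketsCompatible] at h1
            omega
        have hX0 : Xs ≠ [] := by
          rintro rfl
          simp only [juxtapose] at hXs
          omega
        -- With nothing left over, `b` would be the excluded bracket around the whole word.
        have hY0 : Ys ≠ [] := by
          rintro rfl
          rw [List.append_nil] at hne hb3
          exact hne (Prod.ext hi1 (by simp only; omega))
        refine ⟨Es ++ [Xs] ++ [Ys], ?_, ?_, ?_⟩
        · rw [isValid_concat, isValid_concat]
          exact ⟨⟨hEs, hX0, fun X h => hE X (by simp [h])⟩, hY0, fun X h => hE X (by simp [h])⟩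
        · simpa using Operation.splitDot Es [] Xs Ys hX0 hY0
        · have hb' : b = (1, (leftNest Es).1 + (juxtapose Xs).1) :=
            Prod.ext hi1 (by simp only; omega)
          rw [leftNest_concat, leftNest_concat]
          refine Prod.ext ?_ ?_
          · simp only [juxtapose_cons_fst, juxtapose_append_fst, add_assoc]
          · rw [← List.cons_append, juxtapose_cons_snd, juxtapose_append_snd,
              enclose_of_two_le (by rw [juxtapose_cons_fst]; omega), juxtapose_cons_fst, ← hb',
              Finset.insert_union]
      · obtain ⟨E', hE'0, hE', he, hop⟩ := exists_operation_insert hE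
          (b := (b.1 - (leftNest Es).1, b.2 - (leftNest Es).1)) (by simp only; omega)
          (by simp only; omega) (by simp only; omega)
          (fun hmem => hb.2 (mem_shiftBrackets.2
            ⟨_, hmem, Prod.ext (by simp only; omega) (by simp only; omega)⟩))
          fun c hc => by
            have := hcompE c hc
            simp only [BracketsCompatible] at *
            omega
        refine ⟨Es ++ [E'], isValid_concat.2 ⟨hEs, hE'0, hE'⟩, hop Es [], ?_⟩
        rw [leftNest_concat]
        refine Prod.ext ?_ ?_
        · rw [juxtapose_cons_fst, juxtapose_cons_fst, he]
        · have hb' : (b.1 - (leftNest Es).1 + (leftNest Es).1,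
              b.2 - (leftNest Es).1 + (leftNest Es).1) = b :=
            Prod.ext (by simp only; omega) (by simp only; omega)
          simp only [juxtapose_cons_snd, he, shiftBrackets_insert, hb', Finset.union_insert]

namespace CollapsedElement

variable {n : ℕ}

theorem isValid (P : CollapsedElement n) : IsValid P.factors :=
  fun E hE => ⟨P.ne_nil E hE, P.isBracketing E hE⟩

theorem factors_injective : Function.Injective (factors : CollapsedElement n → _) := by
  rintro ⟨Es, _, _, _⟩ ⟨Fs, _, _, _⟩ h
  cases h
  rfl

/-- The bracketing of a word with `n + 1` letters that corresponds to an element of `𝔍'_n`. -/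
def brackets (P : CollapsedElement n) : Finset (ℕ × ℕ) :=
  (leftNest P.factors).2

theorem leftNest_factors_fst (P : CollapsedElement n) : (leftNest P.factors).1 = n + 1 := by
  rw [leftNest_fst, P.length_eq]

theorem isBracketing_brackets (P : CollapsedElement n) : IsBracketing (n + 1) P.brackets := by
  have := (isRule_leftNest P.isValid).2
  rwa [P.leftNest_factors_fst] at this

theorem brackets_injective : Function.Injective (brackets : CollapsedElement n → _) :=
  fun P Q h => factors_injective (leftNest_inj P.isValid Q.isValid
    (Prod.ext (by rw [P.leftNest_factors_fst, Q.leftNest_factors_fst]) h))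

theorem brackets_subset_of_le {P P' : CollapsedElement n} (h : P ≤ P') :
    P'.brackets ⊆ P.brackets := by
  induction h with
  | refl => rfl
  | tail _ hop ih => exact ih.trans hop.refines.2

/-- Missing brackets are added one at a time. Starting from `top` this shows that every bracketing
occurs; in general it turns inclusion of brackets into the order. -/
theorem exists_le_brackets_eq (P : CollapsedElement n) {B : Finset (ℕ × ℕ)}
    (hB : IsBracketing (n + 1) B) (hPB : P.brackets ⊆ B) : ∃ Q ≤ P, Q.brackets = B := by
  induction hk : (B \ P.brackets).card generalizing P with
  | zero =>
    rw [Finset.card_eq_zero, Finset.sdiff_eq_empty_iff_subset] at hk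
    exact ⟨P, .refl, hPB.antisymm hk⟩
  | succ k ih =>
    obtain ⟨b, hb⟩ : (B \ P.brackets).Nonempty := by
      rw [← Finset.card_pos, hk]
      exact k.succ_pos
    obtain ⟨hbB, hbP⟩ := Finset.mem_sdiff.1 hb
    have hb' := hB.1 b hbB
    rw [← P.leftNest_factors_fst] at hb'
    obtain ⟨Es, hv, hop, he⟩ := exists_operation_leftNest_insert P.isValid hb'.1 hb'.2.1
      hb'.2.2.1 hb'.2.2.2 hbP fun c hc => hB.2 b hbB c (hPB hc)
    have hlen := leftNest_fst Es
    rw [he, P.leftNest_factors_fst] at hlen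
    let P' : CollapsedElement n :=
      ⟨Es, fun E hE => (hv E hE).1, fun E hE => (hv E hE).2, (Nat.add_right_cancel hlen).symm⟩
    have hP' : P'.brackets = insert b P.brackets := congrArg Prod.snd he
    obtain ⟨Q, hQ, hQB⟩ := ih P' (by
      rw [hP']
      exact Finset.insert_subset hbB hPB) (by
      rw [hP', Finset.sdiff_insert, Finset.card_erase_of_mem hb, hk]
      rfl)
    exact ⟨Q, Relation.ReflTransGen.head hop hQ, hQB⟩

/-- The product `f(a₁ · a₂ ⋯ aₙ)`. -/
def top (n : ℕ) (hn : 1 ≤ n) : CollapsedElement n where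
  factors := [List.replicate n (1, ∅)]
  ne_nil := by
    simp only [List.mem_singleton, forall_eq, ne_eq, List.replicate_eq_nil_iff]
    omega
  isBracketing E hE X hX := by
    rw [List.mem_singleton.1 hE] at hX
    rw [List.eq_of_mem_replicate hX]
    simp [IsBracketing]
  length_eq := by simp

theorem juxtapose_replicate_snd (n : ℕ) : (juxtapose (List.replicate n (1, ∅))).2 = ∅ := by
  induction n with
  | zero => rfl
  | succ n ih =>
    rw [List.replicate_succ, juxtapose_cons_snd, ih]
    rfl

theorem top_brackets (hn : 1 ≤ n) : (top n hn).brackets = ∅ :=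
  juxtapose_replicate_snd (n + 1)

/-- The poset `𝔍'_n` is isomorphic to the poset of bracketings of `n + 1` letters. -/
noncomputable def isoBracketingPoset (hn : 1 ≤ n) :
    CollapsedElement n ≃o BracketingPoset (n + 1) where
  toEquiv := Equiv.ofBijective
    (fun P => OrderDual.toDual ⟨P.brackets, P.isBracketing_brackets⟩) (by
      constructor
      · intro P Q h
        exact brackets_injective (congrArg Subtype.val (OrderDual.toDual.injective h))
      · rintro ⟨B, hB⟩
        obtain ⟨P, -, rfl⟩ := (top n hn).exists_le_brackets_eq hB
          (by rw [top_brackets]; exact Finset.empty_subset B)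
        exact ⟨P, rfl⟩)
  map_rel_iff' := by
    intro P P'
    refine ⟨fun h => ?_, fun h => brackets_subset_of_le h⟩
    obtain ⟨Q, hQ, he⟩ := P'.exists_le_brackets_eq P.isBracketing_brackets h
    rwa [← brackets_injective he]

end CollapsedElement

end Multiplihedra

/-! ### Loday's cone complex and bracketings -/

section Loday

/-- The bracket that `c` becomes when the `r`-th letter is replaced by `q` letters. -/
def stretch (r q : ℕ) (c : ℕ × ℕ) : ℕ × ℕ :=
  -- A bracket with an end at letter `r` absorbs the whole substituted word, whence `≤` for its
  -- first letter and `<` for its last.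
  (if c.1 ≤ r then c.1 else c.1 + (q - 1), if c.2 < r then c.2 else c.2 + (q - 1))

theorem mem_graft {r q : ℕ} {A B : Finset (ℕ × ℕ)} {b : ℕ × ℕ} :
    b ∈ graft r q A B ↔ b = (r, r + q - 1) ∨ (∃ c ∈ A, stretch r q c = b) ∨
      ∃ c ∈ B, (c.1 + (r - 1), c.2 + (r - 1)) = b := by
  rw [graft, Finset.mem_insert, Finset.mem_union, mem_shiftBrackets, Finset.mem_image]
  rfl

theorem BracketsCompatible.symm {b c : ℕ × ℕ} (h : BracketsCompatible b c) :
    BracketsCompatible c b := by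
  simp only [BracketsCompatible] at *
  omega

theorem bracketsCompatible_stretch_iff {r q : ℕ} {c d : ℕ × ℕ} (hc : c.1 < c.2) (hd : d.1 < d.2) :
    BracketsCompatible (stretch r q c) (stretch r q d) ↔ BracketsCompatible c d := by
  simp only [BracketsCompatible, stretch]
  split_ifs <;> omega

variable {p q r : ℕ}

theorem isBracketing_graft {A B : Finset (ℕ × ℕ)} (hA : IsBracketing p A) (hB : IsBracketing q B)
    (hp : 2 ≤ p) (hq : 2 ≤ q) (hr : 1 ≤ r) (hrp : r ≤ p) :
    IsBracketing (p + q - 1) (graft r q A B) := by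
  have hself : ∀ b : ℕ × ℕ, BracketsCompatible b b := fun b => Or.inl ⟨le_rfl, le_rfl⟩
  have h1 : ∀ c ∈ A, BracketsCompatible (stretch r q c) (r, r + q - 1) := fun c hc => by
    have := hA.1 c hc
    simp only [BracketsCompatible, stretch]
    split_ifs <;> omega
  have h2 : ∀ d ∈ B, BracketsCompatible (r, r + q - 1) (d.1 + (r - 1), d.2 + (r - 1)) :=
    fun d hd => by
      have := hB.1 d hd
      simp only [BracketsCompatible]
      omega
  have h3 : ∀ c ∈ A, ∀ d ∈ B,
      BracketsCompatible (stretch r q c) (d.1 + (r - 1), d.2 + (r - 1)) := fun c hc d hd => by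
    have := hA.1 c hc
    have := hB.1 d hd
    simp only [BracketsCompatible, stretch]
    split_ifs <;> omega
  refine ⟨fun b hb => ?_, fun b hb c hc => ?_⟩
  · rcases mem_graft.1 hb with rfl | ⟨c, hc, rfl⟩ | ⟨c, hc, rfl⟩
    · simp only [ne_eq, Prod.mk.injEq]
      omega
    · obtain ⟨i, j⟩ := c
      have := hA.1 _ hc
      simp only [stretch, ne_eq, Prod.mk.injEq] at *
      split_ifs <;> omega
    · obtain ⟨i, j⟩ := c
      have := hB.1 _ hc
      simp only [ne_eq, Prod.mk.injEq] at *
      omega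
  · rcases mem_graft.1 hb with rfl | ⟨b, hb', rfl⟩ | ⟨b, hb', rfl⟩ <;>
      rcases mem_graft.1 hc with rfl | ⟨c, hc', rfl⟩ | ⟨c, hc', rfl⟩
    · exact hself _
    · exact (h1 c hc').symm
    · exact h2 c hc'
    · exact h1 b hb'
    · exact (bracketsCompatible_stretch_iff (hA.1 b hb').2.1 (hA.1 c hc').2.1).2 (hA.2 b hb' c hc')
    · exact h3 b hb' c hc'
    · exact (h2 b hb').symm
    · exact (h3 c hc' b hb').symm
    · have := hB.2 b hb' c hc'
      simp only [BracketsCompatible] at *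
      omega

/-- Any other bracket of `C` is compatible with the given one: if it lies inside, it comes from `B`
by a shift; otherwise it contains the given bracket or is disjoint from it, and is a stretched
bracket of `A`. -/
theorem exists_eq_graft {C : Finset (ℕ × ℕ)} (hC : IsBracketing (p + q - 1) C)
    (hq : 2 ≤ q) (hr : 1 ≤ r) (hrp : r ≤ p) (hmem : (r, r + q - 1) ∈ C) :
    ∃ A ∈ bracketings p, ∃ B ∈ bracketings q, C = graft r q A B := by
  let A := (Finset.Icc 1 p ×ˢ Finset.Icc 1 p).filter fun c => c.1 < c.2 ∧ stretch r q c ∈ C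
  -- `(1, q)` is left out because its shift is the grafted bracket itself.
  let B := (Finset.Icc 1 q ×ˢ Finset.Icc 1 q).filter fun c =>
    c.1 < c.2 ∧ c ≠ (1, q) ∧ (c.1 + (r - 1), c.2 + (r - 1)) ∈ C
  have hA : ∀ c, c ∈ A ↔ 1 ≤ c.1 ∧ c.1 < c.2 ∧ c.2 ≤ p ∧ stretch r q c ∈ C := fun c => by
    simp only [A, Finset.mem_filter, Finset.mem_product, Finset.mem_Icc]
    constructor
    · rintro ⟨h1, h2, h3⟩
      exact ⟨by omega, h2, by omega, h3⟩
    · rintro ⟨h1, h2, h3, h4⟩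
      exact ⟨by omega, h2, h4⟩
  have hB : ∀ c, c ∈ B ↔ 1 ≤ c.1 ∧ c.1 < c.2 ∧ c.2 ≤ q ∧ c ≠ (1, q) ∧
      (c.1 + (r - 1), c.2 + (r - 1)) ∈ C := fun c => by
    simp only [B, Finset.mem_filter, Finset.mem_product, Finset.mem_Icc]
    constructor
    · rintro ⟨h1, h2, h3⟩
      exact ⟨by omega, h2, by omega, h3⟩
    · rintro ⟨h1, h2, h3, h4⟩
      exact ⟨by omega, h2, h4⟩
  refine ⟨A, ⟨fun c hc => ?_, fun c hc d hd => ?_⟩, B, ⟨fun c hc => ?_, fun c hc d hd => ?_⟩, ?_⟩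
  · obtain ⟨h1, h2, h3, h4⟩ := (hA c).1 hc
    refine ⟨h1, h2, h3, ?_⟩
    rintro rfl
    refine (hC.1 _ h4).2.2.2 (Prod.ext ?_ ?_) <;> simp only [stretch] <;> split_ifs <;> omega
  · obtain ⟨-, h2, -, h4⟩ := (hA c).1 hc
    obtain ⟨-, h2', -, h4'⟩ := (hA d).1 hd
    exact (bracketsCompatible_stretch_iff h2 h2').1 (hC.2 _ h4 _ h4')
  · obtain ⟨h1, h2, h3, h4, -⟩ := (hB c).1 hc
    exact ⟨h1, h2, h3, h4⟩
  · obtain ⟨-, -, -, -, h4⟩ := (hB c).1 hc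
    obtain ⟨-, -, -, -, h4'⟩ := (hB d).1 hd
    have := hC.2 _ h4 _ h4'
    simp only [BracketsCompatible] at *
    omega
  · ext b
    rw [mem_graft]
    constructor
    · obtain ⟨i, j⟩ := b
      intro hb
      have h1 := hC.1 _ hb
      have h2 := hC.2 _ hb _ hmem
      simp only [BracketsCompatible] at h1 h2
      by_cases heq : (i, j) = (r, r + q - 1)
      · exact Or.inl heq
      · by_cases hin : r ≤ i ∧ j ≤ r + q - 1
        · rw [Prod.mk.injEq] at heq
          have he : (i - (r - 1) + (r - 1), j - (r - 1) + (r - 1)) = (i, j) :=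
            Prod.ext (by simp only; omega) (by simp only; omega)
          refine Or.inr (Or.inr ⟨(i - (r - 1), j - (r - 1)), (hB _).2 ?_, he⟩)
          rw [he, ne_eq, Prod.mk.injEq]
          simp only
          exact ⟨by omega, by omega, by omega, by omega, hb⟩
        · rw [Prod.mk.injEq] at heq
          have he : stretch r q (if i ≤ r then i else i - (q - 1),
              if j < r then j else j - (q - 1)) = (i, j) := by
            refine Prod.ext ?_ ?_
            · simp only [stretch]
              split_ifs <;> omega
            · simp only [stretch]
              split_ifs <;> omega
          refine Or.inr (Or.inl ⟨_, (hA _).2 ?_, he⟩)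
          rw [he]
          refine ⟨?_, ?_, ?_, hb⟩
          · simp only
            split_ifs <;> omega
          · simp only
            split_ifs <;> omega
          · simp only
            split_ifs <;> omega
    · rintro (rfl | ⟨c, hc, rfl⟩ | ⟨c, hc, rfl⟩)
      · exact hmem
      · exact ((hA c).1 hc).2.2.2
      · exact ((hB c).1 hc).2.2.2.2

variable {n : ℕ}

/-- The cells of `K̂_n` are the bracketings of `n + 1` letters with a bracket that does not
enclose the last letter. -/
theorem mem_enlargement_iff {y : Finset (ℕ × ℕ)} :
    y ∈ enlargement n ↔ IsBracketing (n + 1) y ∧ ∃ c ∈ y, c.2 ≤ n := by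
  constructor
  · rintro (⟨hn, B, hB, rfl⟩ | ⟨p, q, r, hpq, hp, hq, hr, hrp, A, hA, B, hB, rfl⟩)
    · refine ⟨⟨fun b hb => ?_, fun b hb c hc => ?_⟩, (1, n), Finset.mem_insert_self _ _, le_rfl⟩
      · rcases Finset.mem_insert.1 hb with rfl | hb
        · simp only [ne_eq, Prod.mk.injEq]
          omega
        · obtain ⟨i, j⟩ := b
          have := hB.1 _ hb
          simp only [ne_eq, Prod.mk.injEq] at *
          omega
      · rcases Finset.mem_insert.1 hb with rfl | hb <;> rcases Finset.mem_insert.1 hc with rfl | hc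
        · exact Or.inl ⟨le_rfl, le_rfl⟩
        · have := hB.1 c hc
          exact Or.inl ⟨this.1, this.2.2.1⟩
        · have := hB.1 b hb
          exact Or.inr (Or.inl ⟨this.1, this.2.2.1⟩)
        · exact hB.2 b hb c hc
    · have := isBracketing_graft hA hB (by omega) hq hr (by omega)
      rw [show p + 1 + q - 1 = n + 1 by omega] at this
      exact ⟨this, (r, r + q - 1), mem_graft.2 (Or.inl rfl), by simp only; omega⟩
  · rintro ⟨hy, ⟨i, j⟩, hc, hj⟩
    have h1 := hy.1 _ hc
    simp only at h1 hj
    by_cases he : (i, j) = (1, n)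
    · rw [he] at hc
      rw [Prod.mk.injEq] at he
      refine Or.inl ⟨by omega, y.erase (1, n), ⟨fun b hb => ?_, fun b hb c hc => ?_⟩,
        (Finset.insert_erase hc).symm⟩
      · obtain ⟨hne, hb⟩ := Finset.mem_erase.1 hb
        obtain ⟨k, l⟩ := b
        have h2 := hy.1 _ hb
        have h3 := hy.2 _ hb _ hc
        simp only [ne_eq, Prod.mk.injEq, BracketsCompatible] at *
        omega
      · exact hy.2 b (Finset.mem_of_mem_erase hb) c (Finset.mem_of_mem_erase hc)
    · rw [Prod.mk.injEq] at he
      -- The chosen bracket is the grafted one: `q` is its length, `r` its first letter, and `p` the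
      -- number of letters left when it is contracted in the word without the last letter.
      refine Or.inr ⟨n + 1 - (j - i + 1), j - i + 1, i, by omega, by omega, by omega, by omega,
        by omega, exists_eq_graft ?_ (by omega) (by omega) (by omega) ?_⟩
      · rwa [show n + 1 - (j - i + 1) + 1 + (j - i + 1) - 1 = n + 1 by omega]
      · rwa [show i + (j - i + 1) - 1 = j by omega]

/-- Here the graft is at the last letter: the new bracket reaches the end, while stretching and
shifting preserve whether a bracket stops before it. -/
theorem exists_mem_graft_le_iff {s t : ℕ} {A B : Finset (ℕ × ℕ)} (hs : 1 ≤ s) (ht : 1 ≤ t) :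
    (∃ c ∈ graft s t A B, c.2 ≤ s + t - 2) ↔ (∃ c ∈ A, c.2 ≤ s - 1) ∨ ∃ c ∈ B, c.2 ≤ t - 1 := by
  constructor
  · rintro ⟨b, hb, hle⟩
    rcases mem_graft.1 hb with rfl | ⟨c, hc, rfl⟩ | ⟨c, hc, rfl⟩
    · simp only at hle
      omega
    · refine Or.inl ⟨c, hc, ?_⟩
      simp only [stretch] at hle
      split_ifs at hle <;> omega
    · refine Or.inr ⟨c, hc, ?_⟩
      simp only at hle
      omega
  · rintro (⟨c, hc, hle⟩ | ⟨c, hc, hle⟩)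
    · refine ⟨_, mem_graft.2 (Or.inr (Or.inl ⟨c, hc, rfl⟩)), ?_⟩
      simp only [stretch]
      split_ifs <;> omega
    · refine ⟨_, mem_graft.2 (Or.inr (Or.inr ⟨c, hc, rfl⟩)), ?_⟩
      simp only
      omega

/-- The cells of `A_s` are the cells of `K̂_n` with the bracket that encloses the letters from the
`s`-th to the last one. -/
theorem mem_boundaryPart_iff {s : ℕ} (hs : 2 ≤ s) (hsn : s ≤ n) {y : Finset (ℕ × ℕ)} :
    y ∈ boundaryPart n s ↔ y ∈ enlargement n ∧ (s, n + 1) ∈ y := by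
  obtain ⟨t, ht⟩ : ∃ t, t = n + 2 - s := ⟨_, rfl⟩
  have hn : s + t - 2 = n := by omega
  have hb : s + t - 1 = n + 1 := by omega
  rw [boundaryPart, show n + 1 - s = t - 1 by omega, ← ht, mem_enlargement_iff]
  have hgraft : ∀ {A B : Finset (ℕ × ℕ)}, IsBracketing s A → IsBracketing t B →
      ((∃ c ∈ A, c.2 ≤ s - 1) ∨ ∃ c ∈ B, c.2 ≤ t - 1) →
      (IsBracketing (n + 1) (graft s t A B) ∧ ∃ c ∈ graft s t A B, c.2 ≤ n) ∧
        (s, n + 1) ∈ graft s t A B := fun hA hB h => by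
    refine ⟨⟨?_, ?_⟩, mem_graft.2 (Or.inl (by rw [hb]))⟩
    · rw [← hb]
      exact isBracketing_graft hA hB hs (by omega) (by omega) le_rfl
    · rw [← hn]
      exact (exists_mem_graft_le_iff (by omega) (by omega)).2 h
  constructor
  · rintro (⟨A, hA, B, hB, rfl⟩ | ⟨A, hA, B, hB, rfl⟩)
    · rw [mem_enlargement_iff, Nat.sub_add_cancel (by omega)] at hA
      exact hgraft hA.1 hB (Or.inl hA.2)
    · rw [mem_enlargement_iff, Nat.sub_add_cancel (by omega)] at hB
      exact hgraft hA hB.1 (Or.inr hB.2)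
  · rintro ⟨⟨hy, hc⟩, hmem⟩
    obtain ⟨A, hA, B, hB, rfl⟩ := exists_eq_graft (p := s) (q := t) (r := s) (hb ▸ hy) (by omega)
      (by omega) le_rfl (by rwa [hb])
    rw [← hn, exists_mem_graft_le_iff (by omega) (by omega)] at hc
    refine hc.imp (fun hc => ⟨A, ?_, B, hB, rfl⟩) fun hc => ⟨A, hA, B, ?_, rfl⟩
    · rw [mem_enlargement_iff, Nat.sub_add_cancel (by omega)]
      exact ⟨hA, hc⟩
    · rw [mem_enlargement_iff, Nat.sub_add_cancel (by omega)]
      exact ⟨hB, hc⟩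

theorem enlargement_mono {x y : Finset (ℕ × ℕ)} (hx : x ∈ enlargement n)
    (hy : IsBracketing (n + 1) y) (hxy : x ⊆ y) : y ∈ enlargement n := by
  rw [mem_enlargement_iff] at *
  obtain ⟨-, c, hc, hle⟩ := hx
  exact ⟨hy, c, hxy hc, hle⟩

/-- The bracketing with the brackets that enclose the letters from the `s`-th to the last one,
`s ∈ S`. -/
def finalBrackets (n : ℕ) (S : Finset ℕ) : Finset (ℕ × ℕ) :=
  S.image fun s => (s, n + 1)

theorem mem_finalBrackets {S : Finset ℕ} {b : ℕ × ℕ} :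
    b ∈ finalBrackets n S ↔ ∃ s ∈ S, (s, n + 1) = b := by
  simp [finalBrackets]

theorem isBracketing_finalBrackets {S : Finset ℕ} (hS : S ⊆ Finset.Icc 2 n) :
    IsBracketing (n + 1) (finalBrackets n S) := by
  refine ⟨fun b hb => ?_, fun b hb c hc => ?_⟩
  · obtain ⟨s, hs, rfl⟩ := mem_finalBrackets.1 hb
    have := Finset.mem_Icc.1 (hS hs)
    simp only [ne_eq, Prod.mk.injEq]
    omega
  · obtain ⟨s, -, rfl⟩ := mem_finalBrackets.1 hb
    obtain ⟨t, -, rfl⟩ := mem_finalBrackets.1 hc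
    simp only [BracketsCompatible]
    omega

theorem finalBrackets_notMem_enlargement (S : Finset ℕ) : finalBrackets n S ∉ enlargement n := by
  rw [mem_enlargement_iff]
  rintro ⟨-, c, hc, hle⟩
  obtain ⟨s, -, rfl⟩ := mem_finalBrackets.1 hc
  simp only at hle
  omega

theorem exists_eq_finalBrackets {x : Finset (ℕ × ℕ)} (hx : IsBracketing (n + 1) x)
    (hxe : x ∉ enlargement n) : ∃ S ⊆ Finset.Icc 2 n, x = finalBrackets n S := by
  have hlast : ∀ i j, (i, j) ∈ x → j = n + 1 ∧ i ∈ Finset.Icc 2 n := fun i j hb => by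
    have h1 := hx.1 _ hb
    have h2 : ¬j ≤ n := fun h => hxe (mem_enlargement_iff.2 ⟨hx, _, hb, h⟩)
    simp only [ne_eq, Prod.mk.injEq] at h1
    rw [Finset.mem_Icc]
    omega
  refine ⟨x.image Prod.fst, fun s hs => ?_, ?_⟩
  · obtain ⟨⟨i, j⟩, hb, rfl⟩ := Finset.mem_image.1 hs
    exact (hlast i j hb).2
  · ext ⟨i, j⟩
    rw [mem_finalBrackets]
    constructor
    · intro hb
      exact ⟨i, Finset.mem_image_of_mem Prod.fst hb, by rw [(hlast i j hb).1]⟩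
    · rintro ⟨s, hs, he⟩
      obtain ⟨⟨k, l⟩, hb, hk⟩ := Finset.mem_image.1 hs
      rw [Prod.mk.injEq] at he
      rw [← he.1, ← he.2, ← hk, ← (hlast k l hb).1]
      exact hb

theorem closedCell_finalBrackets {S : Finset ℕ} (hS : S ⊆ Finset.Icc 2 n) :
    closedCell n (finalBrackets n S) = {y ∈ enlargement n | ∀ s ∈ S, y ∈ boundaryPart n s} := by
  ext y
  refine and_congr_right fun hy => ?_
  have hmem : ∀ s ∈ S, (y ∈ boundaryPart n s ↔ (s, n + 1) ∈ y) := fun s hs => by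
    obtain ⟨h1, h2⟩ := Finset.mem_Icc.1 (hS hs)
    rw [mem_boundaryPart_iff h1 h2, and_iff_right hy]
  rw [finalBrackets, Finset.image_subset_iff]
  exact forall₂_congr fun s hs => (hmem s hs).symm

/-- The closed cell of the cone complex that corresponds to a bracketing of `n + 1` letters. -/
def coneCell (n : ℕ) (x : Finset (ℕ × ℕ)) : Set (Option (Finset (ℕ × ℕ))) :=
  {o | (o = none ∧ x ∉ enlargement n) ∨ ∃ y ∈ closedCell n x, some y = o}

theorem none_mem_coneCell {x : Finset (ℕ × ℕ)} : none ∈ coneCell n x ↔ x ∉ enlargement n := by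
  simp [coneCell]

theorem some_mem_coneCell {x y : Finset (ℕ × ℕ)} :
    some y ∈ coneCell n x ↔ y ∈ enlargement n ∧ x ⊆ y := by
  simp [coneCell, closedCell]

theorem coneCell_of_mem {x : Finset (ℕ × ℕ)} (hx : x ∈ enlargement n) :
    coneCell n x = some '' closedCell n x := by
  ext o
  simp [coneCell, hx]

theorem coneCell_finalBrackets {S : Finset ℕ} (hS : S ⊆ Finset.Icc 2 n) :
    coneCell n (finalBrackets n S) =
      insert none (some '' {y ∈ enlargement n | ∀ s ∈ S, y ∈ boundaryPart n s}) := by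
  rw [← closedCell_finalBrackets hS]
  ext o
  simp [coneCell, finalBrackets_notMem_enlargement]

theorem coneCell_mem_lodayCells {x : Finset (ℕ × ℕ)} (hx : IsBracketing (n + 1) x) :
    coneCell n x ∈ lodayCells n := by
  by_cases hxe : x ∈ enlargement n
  · exact Or.inl ⟨x, hxe, coneCell_of_mem hxe⟩
  · obtain ⟨S, hS, rfl⟩ := exists_eq_finalBrackets hx hxe
    exact Or.inr ⟨S, hS, coneCell_finalBrackets hS⟩

theorem exists_coneCell_eq {c : Set (Option (Finset (ℕ × ℕ)))} (hc : c ∈ lodayCells n) :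
    ∃ x ∈ bracketings (n + 1), coneCell n x = c := by
  rcases hc with ⟨x, hx, rfl⟩ | ⟨S, hS, rfl⟩
  · exact ⟨x, (mem_enlargement_iff.1 hx).1, coneCell_of_mem hx⟩
  · exact ⟨finalBrackets n S, isBracketing_finalBrackets hS, coneCell_finalBrackets hS⟩

/-- The bracket `(s - 1, s)` avoids the last letter and crosses `(s, n + 1)`, but no other final
bracket. The resulting cell lies in every A_t with t in `S` and not in A_s, so it separates the
cones. -/
theorem finalBrackets_insert_mem_enlargement {S : Finset ℕ} (hS : S ⊆ Finset.Icc 2 n) {s : ℕ}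
    (hs : s ∈ Finset.Icc 2 n) (hsS : s ∉ S) :
    insert (s - 1, s) (finalBrackets n S) ∈ enlargement n := by
  have hB := isBracketing_finalBrackets hS
  have hs' := Finset.mem_Icc.1 hs
  have hcomp : ∀ t ∈ S, BracketsCompatible (s - 1, s) (t, n + 1) := fun t ht => by
    have hne : t ≠ s := fun he => hsS (he ▸ ht)
    simp only [BracketsCompatible]
    omega
  refine mem_enlargement_iff.2 ⟨⟨fun b hb => ?_, fun b hb c hc => ?_⟩, (s - 1, s),
    Finset.mem_insert_self _ _, hs'.2⟩
  · rcases Finset.mem_insert.1 hb with rfl | hb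
    · simp only [ne_eq, Prod.mk.injEq]
      omega
    · exact hB.1 b hb
  · rcases Finset.mem_insert.1 hb with rfl | hb <;> rcases Finset.mem_insert.1 hc with rfl | hc
    · exact Or.inl ⟨le_rfl, le_rfl⟩
    · obtain ⟨t, ht, rfl⟩ := mem_finalBrackets.1 hc
      exact hcomp t ht
    · obtain ⟨t, ht, rfl⟩ := mem_finalBrackets.1 hb
      exact (hcomp t ht).symm
    · exact hB.2 b hb c hc

/-- A label in the enlarged complex is tested on its own cell. If `x'` is not one, the apex forces
`x` to consist of final brackets too, and a separating cell detects any bracket of `x` missing from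
`x'`. -/
theorem coneCell_subset_iff {x x' : Finset (ℕ × ℕ)} (hx : IsBracketing (n + 1) x)
    (hx' : IsBracketing (n + 1) x') : coneCell n x' ⊆ coneCell n x ↔ x ⊆ x' := by
  constructor
  · intro h
    by_cases hxe' : x' ∈ enlargement n
    · exact (some_mem_coneCell.1 (h (some_mem_coneCell.2 ⟨hxe', subset_rfl⟩))).2
    · have hxe : x ∉ enlargement n := none_mem_coneCell.1 (h (none_mem_coneCell.2 hxe'))
      obtain ⟨S, hS, rfl⟩ := exists_eq_finalBrackets hx hxe
      obtain ⟨S', hS', rfl⟩ := exists_eq_finalBrackets hx' hxe'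
      refine Finset.image_subset_image fun s hs => ?_
      by_contra hs'
      have hy := finalBrackets_insert_mem_enlargement hS' (hS hs) hs'
      have hsub := (some_mem_coneCell.1 (h (some_mem_coneCell.2
        ⟨hy, Finset.subset_insert _ _⟩))).2
      have hmem := hsub (mem_finalBrackets.2 ⟨s, hs, rfl⟩)
      have hsn := Finset.mem_Icc.1 (hS hs)
      rcases Finset.mem_insert.1 hmem with he | hmem
      · rw [Prod.mk.injEq] at he
        omega
      · obtain ⟨t, ht, he⟩ := mem_finalBrackets.1 hmem
        rw [Prod.mk.injEq] at he
        exact hs' (he.1 ▸ ht)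
  · rintro h (_ | y) ho
    · rw [none_mem_coneCell] at *
      exact fun hxe => ho (enlargement_mono hxe hx' h)
    · rw [some_mem_coneCell] at *
      exact ⟨ho.1, h.trans ho.2⟩

/-- The closed cells of Loday's cone complex are the bracketings of `n + 1` letters. -/
noncomputable def lodayIso (n : ℕ) : BracketingPoset (n + 1) ≃o LodayPoset n where
  toEquiv := Equiv.ofBijective
    (fun x => ⟨coneCell n (OrderDual.ofDual x).1,
      coneCell_mem_lodayCells (OrderDual.ofDual x).2⟩) (by
      constructor
      · rintro ⟨x, hx⟩ ⟨y, hy⟩ he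
        have he : coneCell n x = coneCell n y := congrArg Subtype.val he
        exact Subtype.ext (((coneCell_subset_iff hx hy).1 he.superset).antisymm
          ((coneCell_subset_iff hy hx).1 he.subset))
      · rintro ⟨c, hc⟩
        obtain ⟨x, hx, rfl⟩ := exists_coneCell_eq hc
        exact ⟨OrderDual.toDual ⟨x, hx⟩, rfl⟩)
  map_rel_iff' := by
    rintro ⟨x, hx⟩ ⟨y, hy⟩
    exact coneCell_subset_iff hy hx

end Loday

end Associahedra

theorem theorem3p1 (n : ℕ) (hn : 1 ≤ n) :
    (∃ (d : ℕ) (K : Set (Fin d → ℝ)), IsStasheffPolytope (n + 1) K) ∧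
    (∃ (d : ℕ) (J : Set (Fin d → ℝ)), IsCollapsedMultiplihedron n J) ∧
    (∃ C : Set (Fin (n - 1) → ℝ), IsGraphCubeahedron (SimpleGraph.pathGraph (n - 1)) C) ∧
    ∀ (d e : ℕ) (K : Set (Fin d → ℝ)) (J : Set (Fin e → ℝ)) (C : Set (Fin (n - 1) → ℝ)),
      IsStasheffPolytope (n + 1) K →
      IsCollapsedMultiplihedron n J →
      IsGraphCubeahedron (SimpleGraph.pathGraph (n - 1)) C →
      Nonempty (FacePoset K ≃o LodayPoset n) ∧
      Nonempty (FacePoset K ≃o FacePoset J) ∧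
      Nonempty (FacePoset K ≃o FacePoset C) ∧
      Nonempty (FacePoset J ≃o LodayPoset n) ∧
      Nonempty (FacePoset J ≃o FacePoset C) ∧
      Nonempty (FacePoset C ≃o LodayPoset n) := by
  have hcube : ∀ C : Set (Fin (n - 1) → ℝ),
      IsGraphCubeahedron (SimpleGraph.pathGraph (n - 1)) C →
      Nonempty (BracketingPoset (n + 1) ≃o FacePoset C) := fun C hC => by
    have := hC.nonempty_bracketingPoset_orderIso
    rwa [show n - 1 + 2 = n + 1 by omega] at this
  obtain ⟨C, hC⟩ := exists_isGraphCubeahedron (SimpleGraph.pathGraph (n - 1))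
  obtain ⟨eC⟩ := hcube C hC
  have hdim : HasDim C (n - 1) := by simpa using hC.hasDim
  -- One path cubeahedron witnesses all three existence claims: its dimension `n - 1` is the one
  -- required, and its face poset is that of the bracketings.
  refine ⟨⟨n - 1, C, by omega, hC.isConvexPolytope, hdim, ⟨eC.symm⟩⟩,
    ⟨n - 1, C, hn, hC.isConvexPolytope, hdim,
      ⟨eC.symm.trans (CollapsedElement.isoBracketingPoset hn).symm⟩⟩, ⟨C, hC⟩, ?_⟩
  rintro d e K J C ⟨-, -, -, ⟨eK⟩⟩ ⟨-, -, -, ⟨eJ'⟩⟩ hC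
  obtain ⟨eC⟩ := hcube C hC
  have eJ := eJ'.trans (CollapsedElement.isoBracketingPoset hn)
  have eL := lodayIso n
  exact ⟨⟨eK.trans eL⟩, ⟨eK.trans eJ.symm⟩, ⟨eK.trans eC⟩, ⟨eJ.trans eL⟩, ⟨eJ.trans eC⟩,
    ⟨eC.symm.trans eL⟩⟩
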